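/- Let $M$ be a number of transmit antennas and consider the fading Gaussian MISO wiretap channel $$y_t=\boldsymbol h_t^{\mathsf T}\boldsymbol x_t+e_t,\qquad z_t=\boldsymbol g_t^{\mathsf T}\boldsymbol x_t+b_t,\qquad t=1,\dots,n,$$ where $y_t$ is observed by the legitimate receiver and $z_t$ by the eavesdropper, the channel vectors $\boldsymbol h_t,\boldsymbol g_t\in\mathbb C^M$ are mutually independent with a common law $\nu$ such that $\mathbb E\log(1+\|\boldsymbol h_t\|^2)<\infty$, and the noises $e_t,b_t$ are i.i.d. circularly symmetric complex Gaussian of mean $0$ and variance $1$. A code of block length $n$ without instantaneous channel state information at the transmitter (CSIT), delayed CSIT being allowed, consists of a message $W$ uniform on $\{1,\dots,M_n\}$, private randomness $S$ of the encoder with arbitrary law, measurable encoders $\boldsymbol x_t=F_t(W,S,\boldsymbol h_1,\dots,\boldsymbol h_{t-1},\boldsymbol g_1,\dots,\boldsymbol g_{t-1})\in\mathbb C^M$, and a measurable decoder $\hat W=\hat W(y^n,\boldsymbol h^n,\boldsymbol g^n)$; the encoders and the decoder may ignore any of their arguments. The message, $S$, the channel vectors and the noises are mutually independent. The code has power $P$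 if $\frac1n\sum_{t=1}^n\mathbb E\|\boldsymbol x_t\|^2\le P$ (in particular if $\frac1n\sum_t\|\boldsymbol x_t\|^2\le P$ always), and its error probability is $P_e^{(n)}=\Pr\{\hat W\ne W\}$. A number $d\ge 0$ is an achievable secrecy degree of freedom if there are codes of every block length $n$ and every power $P>0$, with $M_n(P)$ messages, such that $\lim_{n\to\infty}P_e^{(n)}=0$ for every $P>0$, $$\liminf_{P\to\infty}\ \liminf_{n\to\infty}\frac{n^{-1}\log_2 M_n(P)}{\log_2 P}\ge d\qquad\text{and}\qquad \lim_{P\to\infty}\ \limsup_{n\to\infty}\frac{n^{-1}I(W;z^n,\boldsymbol h^n,\boldsymbol g^n)}{\log_2 P}=0 .$$ **Theorem.** The secrecy degrees of freedom of this channel, that is, the supremum of all achievable $d$, are at most $\tfrac23$. -/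

import Mathlib

open MeasureTheory Filter Topology
open scoped ENNReal NNReal

noncomputable section

namespace Wiretap

/-- Channel vectors and channel inputs of a transmitter with `M` antennas: vectors in `ℂ^M`. -/
abbrev Vec (M : ℕ) : Type := Fin M → ℂ

/-- Squared Euclidean norm of `x`, that is `tr (x xᴴ)`. -/
def sqNorm {M : ℕ} (x : Vec M) : ℝ := ∑ i, ‖x i‖ ^ 2

/-- The circularly symmetric complex Gaussian law of mean `0` and variance `1`: real and imaginary
parts are independent real Gaussians of mean `0` and variance `1 / 2`. -/
def stdComplexGaussian : Measure ℂ :=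
  ((ProbabilityTheory.gaussianReal 0 (1 / 2)).prod
    (ProbabilityTheory.gaussianReal 0 (1 / 2))).map Complex.measurableEquivRealProd.symm

/-- A code of block length `n` for the MISO wiretap channel with `M` transmit antennas, without
instantaneous channel state information at the transmitter.

The stochastic encoders draw from a private random variable with an arbitrary law `randLaw`; the
input at time `t` is a function of the message, of that random variable and of the past channel
vectors `h_1, …, h_{t-1}` and `g_1, …, g_{t-1}` of both channels (delayed information). Encoders
that ignore one or both of the pasts are special cases. The decoder sees the outputs `y^n` and the
channel vectors `h^n`, `g^n`; decoders that use only `(y^n, h^n)` are special cases. -/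
structure Code (M n : ℕ) where
  /-- number of messages -/
  numMsg : ℕ
  numMsg_pos : 0 < numMsg
  /-- the space of the private randomness of the encoder, and its law -/
  Rand : Type
  [measurableSpaceRand : MeasurableSpace Rand]
  randLaw : Measure Rand
  [isProbabilityMeasure_randLaw : IsProbabilityMeasure randLaw]
  /-- the encoders: message, private randomness, past of `h`, past of `g` -/
  enc : (t : Fin n) → Fin numMsg × Rand × (Fin t → Vec M) × (Fin t → Vec M) → Vec M
  measurable_enc : ∀ t, Measurable (enc t)
  /-- the decoder: outputs `y`, channel vectors `h` and `g` -/
  dec : (Fin n → ℂ) × (Fin n → Vec M) × (Fin n → Vec M) → Fin numMsg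
  measurable_dec : Measurable dec

attribute [instance] Code.measurableSpaceRand Code.isProbabilityMeasure_randLaw

/-- Mutual information, in bits, of two random variables under `μ`: the Kullback-Leibler divergence
of the joint law from the product of the marginal laws. -/
def mutualInfo {Ω α β : Type*} [MeasurableSpace Ω] [MeasurableSpace α] [MeasurableSpace β]
    (μ : Measure Ω) (X : Ω → α) (Y : Ω → β) : ℝ≥0∞ :=
  InformationTheory.klDiv (μ.map fun ω => (X ω, Y ω)) ((μ.map X).prod (μ.map Y)) /
    ENNReal.ofReal (Real.log 2)

namespace Code

variable {M n : ℕ} (C : Code M n)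

/-- The sample space: message, private randomness, channel vectors `h` of the legitimate receiver
and `g` of the eavesdropper, noise `e` of the legitimate receiver and `b` of the eavesdropper. -/
abbrev Sample : Type :=
  Fin C.numMsg × C.Rand × (Fin n → Vec M) × (Fin n → Vec M) × (Fin n → ℂ) × (Fin n → ℂ)

/-- The law on the sample space when each channel vector has law `ν`: the message is uniform,
and the message, the private randomness, all the channel vectors `h_t`, `g_t` and all the noises
`e_t`, `b_t` are mutually independent. -/
def law (ν : Measure (Vec M)) : Measure C.Sample :=
  (ProbabilityTheory.uniformOn (Set.univ : Set (Fin C.numMsg))).prod <| C.randLaw.prod <|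
    (Measure.pi fun _ : Fin n => ν).prod <| (Measure.pi fun _ : Fin n => ν).prod <|
      (Measure.pi fun _ : Fin n => stdComplexGaussian).prod
        (Measure.pi fun _ : Fin n => stdComplexGaussian)

/-- The message `W`. -/
def msg (ω : C.Sample) : Fin C.numMsg := ω.1

/-- The channel vectors `h^n` of the legitimate receiver. -/
def chanH (ω : C.Sample) : Fin n → Vec M := ω.2.2.1

/-- The channel vectors `g^n` of the eavesdropper. -/
def chanG (ω : C.Sample) : Fin n → Vec M := ω.2.2.2.1

/-- The noise `e^n` of the legitimate receiver. -/
def noiseE (ω : C.Sample) : Fin n → ℂ := ω.2.2.2.2.1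

/-- The noise `b^n` of the eavesdropper. -/
def noiseB (ω : C.Sample) : Fin n → ℂ := ω.2.2.2.2.2

/-- The channel input `x_t`, computed from the strict past of the channel vectors. -/
def input (ω : C.Sample) (t : Fin n) : Vec M :=
  C.enc t (C.msg ω, ω.2.1,
    fun s => C.chanH ω (Fin.castLE t.isLt.le s), fun s => C.chanG ω (Fin.castLE t.isLt.le s))

/-- The output `y_t = h_tᵀ x_t + e_t` of the legitimate receiver. -/
def outY (ω : C.Sample) (t : Fin n) : ℂ :=
  (∑ i, C.chanH ω t i * C.input ω t i) + C.noiseE ω t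

/-- The output `z_t = g_tᵀ x_t + b_t` of the eavesdropper. -/
def outZ (ω : C.Sample) (t : Fin n) : ℂ :=
  (∑ i, C.chanG ω t i * C.input ω t i) + C.noiseB ω t

/-- The average power constraint `𝔼[∑ t, tr (x_t x_tᴴ)] ≤ n P`. It holds in particular if
`∑ t, tr (x_t x_tᴴ) ≤ n P` for every realization. -/
def PowerConstraint (ν : Measure (Vec M)) (P : ℝ) : Prop :=
  ∫⁻ ω, ENNReal.ofReal (∑ t, sqNorm (C.input ω t)) ∂(C.law ν) ≤ ENNReal.ofReal (n * P)

/-- The probability that the decoded message differs from the message. -/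
def errorProb (ν : Measure (Vec M)) : ℝ≥0∞ :=
  C.law ν {ω | C.dec (C.outY ω, C.chanH ω, C.chanG ω) ≠ C.msg ω}

/-- The rate `n⁻¹ log₂ M_n` in bits per channel use. -/
def rate : ℝ := Real.logb 2 C.numMsg / n

/-- The information `I(W; Z^n, H^n, G^n)`, in bits, that leaks to the eavesdropper. -/
def leakage (ν : Measure (Vec M)) : ℝ≥0∞ :=
  mutualInfo (C.law ν) C.msg fun ω => (C.outZ ω, C.chanH ω, C.chanG ω)

end Code

/-- `d` is an achievable number of secrecy degrees of freedom (`ν` is the law of each channel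
vector): there are codes `C P n` of block length `n` and power `P` whose error probability tends
to `0` as `n → ∞` for every `P > 0`, whose normalized rate is asymptotically at least `d`, and
whose normalized leakage is asymptotically `0`. The limit inferior in `P` is the limit whenever
that limit exists. -/
def Achievable {M : ℕ} (ν : Measure (Vec M)) (d : ℝ≥0) : Prop :=
  ∃ C : ℝ → (n : ℕ) → Code M n,
    (∀ P, 0 < P → ∀ n, (C P n).PowerConstraint ν P) ∧
    (∀ P, 0 < P → Tendsto (fun n => (C P n).errorProb ν) atTop (𝓝 0)) ∧
    (((d : ℝ) : EReal) ≤ liminf (fun P : ℝ =>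
      liminf (fun n : ℕ => (((C P n).rate / Real.logb 2 P : ℝ) : EReal)) atTop) atTop) ∧
    Tendsto (fun P : ℝ => limsup (fun n : ℕ =>
      (C P n).leakage ν / (n * ENNReal.ofReal (Real.logb 2 P))) atTop) atTop (𝓝 0)

/-- The fundamental secrecy degrees of freedom: the supremum of the achievable ones. -/
def sdof {M : ℕ} (ν : Measure (Vec M)) : ℝ≥0∞ :=
  ⨆ (d : ℝ≥0) (_ : Achievable ν d), (d : ℝ≥0∞)

end Wiretap

end

/-! Write h for differential entropy conditioned on all channel vectors. The input x_t is determined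
by the message, the private randomness and the past, and the two channels have the same law. So,
given the past of both receivers, y_t and z_t have the same conditional law. Splitting h(y^n, z^n)
over time, each slot contributes at most twice the entropy of either output given the past, and that
is at most its entropy given the past of that output alone. Hence h(y^n, z^n) ≤ 2 h(z^n), and, given
the message, J := h(y^n, z^n | W) ≤ 2 h(y^n | W) (`lintegral_negLog_mixLik_le`, applied in
`outEnt_jointDens_le` and `condEnt_jointDens_le`).

Let ε be the Fano term and L the leakage in nats. Fano's inequality for y^n, doubled, gives 2 log
M_n + J ≤ 2 h(y^n) + 2ε. Fano's inequality for (y^n, z^n) gives log M_n + J ≤ h(y^n, z^n) + ε ≤ 2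
h(z^n) + ε, while h(z^n) ≤ h(z^n | W) + L ≤ J + L. Adding up, J cancels: 3 log M_n ≤ 2 h(y^n) + 2L +
3ε (`three_mul_log_numMsg_le`). The power constraint gives h(y^n) ≤ n (log P + O(1)), hence the
bound 2/3.

Noise of variance 1 has density at most 1/π, so every density that occurs is at most 1 and every
entropy is an element of [0, ∞]. No integrability has to be checked before an entropy is written
down, and the main inequalities become Gibbs' inequality against a well chosen comparison density.
-/

noncomputable section

namespace Wiretap

set_option linter.unusedSectionVars false

/-! ### Entropy of densities bounded by one, and Gibbs' inequality -/

/-- The negative logarithm of a density with values in `[0, 1]`. -/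
def negLog (p : ℝ≥0∞) : ℝ≥0∞ := ENNReal.ofReal (-Real.log p.toReal)

@[fun_prop]
lemma measurable_negLog : Measurable negLog :=
  (Real.measurable_log.comp ENNReal.measurable_toReal).neg.ennreal_ofReal

@[simp]
lemma negLog_one : negLog 1 = 0 := by simp [negLog]

lemma toReal_mem_of_pos_le_one {p : ℝ≥0∞} (h0 : 0 < p) (h1 : p ≤ 1) :
    0 < p.toReal ∧ p.toReal ≤ 1 :=
  ⟨ENNReal.toReal_pos h0.ne' (h1.trans_lt ENNReal.one_lt_top).ne,
    by simpa using ENNReal.toReal_mono ENNReal.one_ne_top h1⟩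

lemma negLog_ne_top (p : ℝ≥0∞) : negLog p ≠ ∞ := ENNReal.ofReal_ne_top

lemma toReal_negLog {p : ℝ≥0∞} (h1 : p ≤ 1) : (negLog p).toReal = -Real.log p.toReal := by
  refine ENNReal.toReal_ofReal ?_
  have := Real.log_nonpos ENNReal.toReal_nonneg
    (by simpa using ENNReal.toReal_mono ENNReal.one_ne_top h1)
  linarith

lemma negLog_mul {p q : ℝ≥0∞} (hp : 0 < p) (hp1 : p ≤ 1) (hq : 0 < q) (hq1 : q ≤ 1) :
    negLog (p * q) = negLog p + negLog q := by
  obtain ⟨a0, a1⟩ := toReal_mem_of_pos_le_one hp hp1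
  obtain ⟨b0, b1⟩ := toReal_mem_of_pos_le_one hq hq1
  have ha := Real.log_nonpos a0.le a1
  have hb := Real.log_nonpos b0.le b1
  rw [negLog, negLog, negLog, ← ENNReal.ofReal_add (by linarith) (by linarith),
    ENNReal.toReal_mul, Real.log_mul a0.ne' b0.ne', neg_add]

lemma negLog_prod {ι : Type*} (s : Finset ι) (p : ι → ℝ≥0∞) (h0 : ∀ i, 0 < p i)
    (h1 : ∀ i, p i ≤ 1) : negLog (∏ i ∈ s, p i) = ∑ i ∈ s, negLog (p i) := by
  classical
  induction s using Finset.induction_on with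
  | empty => simp
  | insert i s hi ih =>
    rw [Finset.prod_insert hi, Finset.sum_insert hi, negLog_mul (h0 i) (h1 i) _
      (Finset.prod_le_one' fun j _ => h1 j), ih]
    exact pos_iff_ne_zero.2 (Finset.prod_ne_zero_iff.2 fun j _ => (h0 j).ne')

lemma negLog_anti {p q : ℝ≥0∞} (hp : 0 < p) (hpq : p ≤ q) (hq1 : q ≤ 1) :
    negLog q ≤ negLog p := by
  obtain ⟨a0, _⟩ := toReal_mem_of_pos_le_one hp (hpq.trans hq1)
  refine ENNReal.ofReal_le_ofReal (neg_le_neg (Real.log_le_log a0 ?_))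
  exact ENNReal.toReal_mono (hq1.trans_lt ENNReal.one_lt_top).ne hpq

/-- The pointwise form of Gibbs' inequality. -/
lemma mul_negLog_add_le {p q : ℝ≥0∞} (hp : 0 < p) (hp1 : p ≤ 1) (hq : 0 < q) (hq1 : q ≤ 1) :
    p * negLog p + p ≤ p * negLog q + q := by
  obtain ⟨a0, a1⟩ := toReal_mem_of_pos_le_one hp hp1
  obtain ⟨b0, b1⟩ := toReal_mem_of_pos_le_one hq hq1
  have hpt := (hp1.trans_lt ENNReal.one_lt_top).ne
  have hqt := (hq1.trans_lt ENNReal.one_lt_top).ne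
  have n1 := negLog_ne_top p
  have n2 := negLog_ne_top q
  rw [← ENNReal.toReal_le_toReal (by finiteness) (by finiteness),
    ENNReal.toReal_add (by finiteness) hpt, ENNReal.toReal_add (by finiteness) hqt,
    ENNReal.toReal_mul, ENNReal.toReal_mul, toReal_negLog hp1, toReal_negLog hq1]
  -- This is `log x ≤ x - 1` at `x = q / p`, multiplied by `p`. The masses `p` and `q` stay on their
  -- sides, so nothing is subtracted in `ℝ≥0∞`.
  have h := Real.log_le_sub_one_of_pos (div_pos b0 a0)
  rw [Real.log_div b0.ne' a0.ne'] at h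
  have h2 := mul_le_mul_of_nonneg_left h a0.le
  rw [mul_sub, mul_sub, mul_div_cancel₀ _ a0.ne'] at h2
  linarith

/-- Gibbs' inequality: the cross entropy is at least the entropy. -/
lemma lintegral_negLog_le {α : Type*} [MeasurableSpace α] {ρ : Measure α} {p q : α → ℝ≥0∞}
    (hp : Measurable p) (hq : Measurable q) (hp0 : ∀ a, 0 < p a) (hp1 : ∀ a, p a ≤ 1)
    (hq0 : ∀ a, 0 < q a) (hq1 : ∀ a, q a ≤ 1) (hint : ∫⁻ a, p a ∂ρ ≠ ∞)
    (hle : ∫⁻ a, q a ∂ρ ≤ ∫⁻ a, p a ∂ρ) :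
    ∫⁻ a, p a * negLog (p a) ∂ρ ≤ ∫⁻ a, p a * negLog (q a) ∂ρ := by
  refine ENNReal.le_of_add_le_add_right hint ?_
  calc ∫⁻ a, p a * negLog (p a) ∂ρ + ∫⁻ a, p a ∂ρ
      = ∫⁻ a, (p a * negLog (p a) + p a) ∂ρ := (lintegral_add_right _ hp).symm
    _ ≤ ∫⁻ a, (p a * negLog (q a) + q a) ∂ρ :=
        lintegral_mono fun a => mul_negLog_add_le (hp0 a) (hp1 a) (hq0 a) (hq1 a)
    _ = ∫⁻ a, p a * negLog (q a) ∂ρ + ∫⁻ a, q a ∂ρ := lintegral_add_right _ hq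
    _ ≤ _ := by gcongr

lemma lintegral_pos_of_pos {α : Type*} [MeasurableSpace α] {μ : Measure α} [NeZero μ]
    {f : α → ℝ≥0∞} (hf : Measurable f) (h : ∀ a, 0 < f a) : 0 < ∫⁻ a, f a ∂μ := by
  rw [lintegral_pos_iff_support hf, show Function.support f = Set.univ from
    Set.eq_univ_of_forall fun a => (h a).ne']
  exact NeZero.pos _

lemma lintegral_le_one_of_le_one {α : Type*} [MeasurableSpace α] {μ : Measure α}
    [IsProbabilityMeasure μ] {f : α → ℝ≥0∞} (h : ∀ a, f a ≤ 1) : ∫⁻ a, f a ∂μ ≤ 1 :=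
  (lintegral_mono h).trans (by simp)

/-! ### Observations made over time, with inputs depending on the past -/

section Sequential

variable {V D Θ : Type*} [MeasurableSpace V] [MeasurableSpace D] [MeasurableSpace Θ]

/-- The likelihood of the first `n` observations `d`, when the observation at time `t` has density
`ψ (x, ·)` and the input `x = X t (θ, d_1, …, d_{t-1})` depends on the past. -/
def seqLik (ψ : V × D → ℝ≥0∞) (X : (n : ℕ) → Θ × (Fin n → D) → V) :
    (n : ℕ) → Θ × (Fin n → D) → ℝ≥0∞
  | 0, _ => 1
  | n + 1, p => seqLik ψ X n (p.1, Fin.init p.2) *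
      ψ (X n (p.1, Fin.init p.2), p.2 (Fin.last n))

/-- The density of the first `n` observations when `θ` has law `lam`. -/
def mixLik (ψ : V × D → ℝ≥0∞) (X : (n : ℕ) → Θ × (Fin n → D) → V) (lam : Measure Θ) (n : ℕ)
    (d : Fin n → D) : ℝ≥0∞ :=
  ∫⁻ θ, seqLik ψ X n (θ, d) ∂lam

/-- The density of the first `n` observations `d` together with one further observation `a`, which
has density `φ (x, ·)` for the input `x` at time `n`. -/
def mixNext {A : Type*} (ψ : V × D → ℝ≥0∞) (φ : V × A → ℝ≥0∞) (X : (n : ℕ) → Θ × (Fin n → D) → V)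
    (lam : Measure Θ) (n : ℕ) (d : Fin n → D) (a : A) : ℝ≥0∞ :=
  ∫⁻ θ, seqLik ψ X n (θ, d) * φ (X n (θ, d), a) ∂lam

@[fun_prop]
lemma measurable_init (n : ℕ) : Measurable (Fin.init : (Fin (n + 1) → D) → Fin n → D) :=
  measurable_pi_lambda _ fun _ => measurable_pi_apply _

variable {ψ : V × D → ℝ≥0∞} {X : (n : ℕ) → Θ × (Fin n → D) → V}

@[fun_prop]
lemma measurable_seqLik (hψ : Measurable ψ) (hX : ∀ n, Measurable (X n)) (n : ℕ) :
    Measurable (seqLik ψ X n) := by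
  induction n with
  | zero => exact measurable_const
  | succ n ih =>
    have h : Measurable fun p : Θ × (Fin (n + 1) → D) => (p.1, Fin.init (α := fun _ => D) p.2) := by
      fun_prop
    exact (ih.comp h).mul (hψ.comp (((hX n).comp h).prodMk (by fun_prop)))

lemma seqLik_pos (h : ∀ p, 0 < ψ p) (n : ℕ) (p : Θ × (Fin n → D)) : 0 < seqLik ψ X n p := by
  induction n with
  | zero => exact one_pos
  | succ n ih => exact ENNReal.mul_pos (ih _).ne' (h _).ne'

lemma seqLik_le_one (h : ∀ p, ψ p ≤ 1) (n : ℕ) (p : Θ × (Fin n → D)) : seqLik ψ X n p ≤ 1 := by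
  induction n with
  | zero => exact le_rfl
  | succ n ih => exact mul_le_one' (ih _) (h _)

variable {lam : Measure Θ} [IsProbabilityMeasure lam]

lemma measurable_mixLik (hψ : Measurable ψ) (hX : ∀ n, Measurable (X n)) (n : ℕ) :
    Measurable (mixLik ψ X lam n) :=
  Measurable.lintegral_prod_left' (measurable_seqLik hψ hX n)

lemma mixLik_pos (hψ : Measurable ψ) (hX : ∀ n, Measurable (X n)) (h : ∀ p, 0 < ψ p) (n : ℕ)
    (d : Fin n → D) : 0 < mixLik ψ X lam n d :=
  lintegral_pos_of_pos ((measurable_seqLik hψ hX n).comp (by fun_prop)) fun _ => seqLik_pos h _ _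

lemma mixLik_le_one (h : ∀ p, ψ p ≤ 1) (n : ℕ) (d : Fin n → D) : mixLik ψ X lam n d ≤ 1 :=
  lintegral_le_one_of_le_one fun _ => seqLik_le_one h _ _

section Next

variable {A : Type*} [MeasurableSpace A] {φ : V × A → ℝ≥0∞}

lemma measurable_mixNext (hψ : Measurable ψ) (hφ : Measurable φ) (hX : ∀ n, Measurable (X n))
    (n : ℕ) : Measurable (Function.uncurry (mixNext ψ φ X lam n)) := by
  have h : Measurable fun q : Θ × ((Fin n → D) × A) =>
      seqLik ψ X n (q.1, q.2.1) * φ (X n (q.1, q.2.1), q.2.2) := by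
    have h1 : Measurable fun q : Θ × ((Fin n → D) × A) => (q.1, q.2.1) := by fun_prop
    exact ((measurable_seqLik hψ hX n).comp h1).mul
      (hφ.comp (((hX n).comp h1).prodMk (by fun_prop)))
  exact Measurable.lintegral_prod_left' h

lemma measurable_seqLik_mul (hψ : Measurable ψ) (hφ : Measurable φ) (hX : ∀ n, Measurable (X n))
    (n : ℕ) (d : Fin n → D) :
    Measurable fun q : Θ × A => seqLik ψ X n (q.1, d) * φ (X n (q.1, d), q.2) := by
  have h1 : Measurable fun q : Θ × A => (q.1, d) := by fun_prop
  exact ((measurable_seqLik hψ hX n).comp h1).mul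
      (hφ.comp (((hX n).comp h1).prodMk (by fun_prop)))

/-- By Tonelli the newest observation integrates to 1 for each `θ`. Dividing `mixNext` by `mixLik`
therefore yields a conditional density of the next observation. -/
lemma lintegral_mixNext {α : Measure A} [SFinite α] (hψ : Measurable ψ) (hφ : Measurable φ)
    (hX : ∀ n, Measurable (X n)) (hint : ∀ x, ∫⁻ a, φ (x, a) ∂α = 1) (n : ℕ) (d : Fin n → D) :
    ∫⁻ a, mixNext ψ φ X lam n d a ∂α = mixLik ψ X lam n d := by
  unfold mixNext mixLik
  rw [lintegral_lintegral_swap (by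
    have := (measurable_seqLik_mul hψ hφ hX n d).comp (measurable_swap (α := A))
    exact this.aemeasurable)]
  refine lintegral_congr fun θ => ?_
  have h : Measurable fun a => φ (X n (θ, d), a) := hφ.comp (by fun_prop)
  rw [lintegral_const_mul _ h, hint, mul_one]

end Next

/-- Fubini for the last time slot, the form in which every induction over time uses the product
measure. -/
lemma lintegral_init_last {κ : Measure D} [SigmaFinite κ] (n : ℕ) {F : (Fin n → D) → D → ℝ≥0∞}
    (hF : Measurable (Function.uncurry F)) :
    ∫⁻ d, F (Fin.init d) (d (Fin.last n)) ∂(Measure.pi fun _ : Fin (n + 1) => κ) =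
      ∫⁻ d, ∫⁻ a, F d a ∂κ ∂(Measure.pi fun _ : Fin n => κ) := by
  have h := measurePreserving_piFinSuccAbove (fun _ : Fin (n + 1) => κ) (Fin.last n)
  have h2 := h.lintegral_comp (f := fun q => F q.2 q.1) (hF.comp measurable_swap)
  rw [lintegral_prod_symm (fun b : D × (Fin n → D) => F b.2 b.1)
    (hF.comp measurable_swap).aemeasurable] at h2
  rw [← h2]
  refine lintegral_congr fun d => ?_
  simp only [MeasurableEquiv.piFinSuccAbove_apply, Fin.insertNthEquiv_symm_apply]
  congr 1
  ext i
  simp [Fin.init, Fin.removeNth]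

/-! ### The doubling inequality -/

section Doubling

variable {A : Type*} [MeasurableSpace A] {α : Measure A} [SigmaFinite α] {ψ : V × A → ℝ≥0∞}
  {X : (n : ℕ) → Θ × (Fin n → A × A) → V} {pr : A × A → A}

/-- If at each time two observations with the same conditional law are made, the entropy of all the
observations is at most twice the entropy of one half of them. -/
theorem lintegral_negLog_mixLik_le (hψ : Measurable ψ) (hψ0 : ∀ p, 0 < ψ p) (hψ1 : ∀ p, ψ p ≤ 1)
    (hint : ∀ x, ∫⁻ a, ψ (x, a) ∂α = 1) (hX : ∀ n, Measurable (X n))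
    (hpr : pr = Prod.fst ∨ pr = Prod.snd) (n : ℕ) :
    ∫⁻ d, mixLik (fun p => ψ (p.1, p.2.1) * ψ (p.1, p.2.2)) X lam n d *
        negLog (mixLik (fun p => ψ (p.1, p.2.1) * ψ (p.1, p.2.2)) X lam n d)
        ∂(Measure.pi fun _ : Fin n => α.prod α) ≤
      2 * ∫⁻ d, mixLik (fun p => ψ (p.1, p.2.1) * ψ (p.1, p.2.2)) X lam n d *
        negLog (mixLik (fun p => ψ (p.1, pr p.2)) X lam n d)
        ∂(Measure.pi fun _ : Fin n => α.prod α) := by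
  have hprm : Measurable pr := by rcases hpr with rfl | rfl <;> fun_prop
  set ψ2 : V × (A × A) → ℝ≥0∞ := fun p => ψ (p.1, p.2.1) * ψ (p.1, p.2.2) with hψ2
  set ψ1 : V × (A × A) → ℝ≥0∞ := fun p => ψ (p.1, pr p.2) with hψ1'
  have m2 : Measurable ψ2 := by fun_prop
  have m1 : Measurable ψ1 := by fun_prop
  have pos2 : ∀ p, 0 < ψ2 p := fun p => ENNReal.mul_pos (hψ0 _).ne' (hψ0 _).ne'
  have le2 : ∀ p, ψ2 p ≤ 1 := fun p => mul_le_one' (hψ1 _) (hψ1 _)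
  have pos1 : ∀ p, 0 < ψ1 p := fun p => hψ0 _
  have le1 : ∀ p, ψ1 p ≤ 1 := fun p => hψ1 _
  have int2 : ∀ x, ∫⁻ a, ψ2 (x, a) ∂(α.prod α) = 1 := by
    intro x
    have h : Measurable fun a => ψ (x, a) := by fun_prop
    rw [hψ2, lintegral_prod_mul (f := fun a => ψ (x, a)) (g := fun a => ψ (x, a))
      h.aemeasurable h.aemeasurable, hint, one_mul]
  -- `T` is the density of all observations. In `G` only the half selected by `pr` enters the
  -- likelihood, but the inputs still read the full past, so `G` is a causally conditioned density.
  set T := fun n => mixLik ψ2 X lam n with hT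
  set G := fun n => mixLik ψ1 X lam n with hG
  have mT : ∀ n, Measurable (T n) := measurable_mixLik m2 hX
  have mG : ∀ n, Measurable (G n) := measurable_mixLik m1 hX
  have posT : ∀ n d, 0 < T n d := mixLik_pos m2 hX pos2
  have leT : ∀ n d, T n d ≤ 1 := mixLik_le_one le2
  have posG : ∀ n d, 0 < G n d := mixLik_pos m1 hX pos1
  have leG : ∀ n d, G n d ≤ 1 := mixLik_le_one le1
  have marg : ∀ n (F : (Fin n → A × A) → ℝ≥0∞), Measurable F →
      ∫⁻ d, T (n + 1) d * F (Fin.init d) ∂(Measure.pi fun _ : Fin (n + 1) => α.prod α) =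
        ∫⁻ d, T n d * F d ∂(Measure.pi fun _ : Fin n => α.prod α) := by
    intro n F hF
    have := lintegral_init_last (κ := α.prod α) n (F := fun d a => mixNext ψ2 ψ2 X lam n d a * F d)
      ((measurable_mixNext m2 m2 hX n).mul (hF.comp measurable_fst))
    refine this.trans (lintegral_congr fun d => ?_)
    have hm : Measurable (mixNext ψ2 ψ2 X lam n d) :=
      (measurable_mixNext m2 m2 hX n).comp (by fun_prop : Measurable fun a => (d, a))
    rw [lintegral_mul_const _ hm, lintegral_mixNext m2 m2 hX int2]
  have totT : ∀ n, ∫⁻ d, T n d ∂(Measure.pi fun _ : Fin n => α.prod α) = 1 := by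
    intro n
    induction n with
    | zero => simp [hT, mixLik, seqLik]
    | succ n ih => simpa [ih] using marg n (fun _ => 1) measurable_const
  change ∫⁻ d, T n d * negLog (T n d) ∂_ ≤ 2 * ∫⁻ d, T n d * negLog (G n d) ∂_
  induction n with
  | zero => simp [hT, mixLik, seqLik]
  | succ n ih =>
    set N := mixNext ψ1 ψ X lam n with hN
    have mN : Measurable (Function.uncurry N) := measurable_mixNext m1 hψ hX n
    -- `K d` is the conditional density of one further observation when the past is weighed by the
    -- selected half alone. Its argument is a single observation, so it can be evaluated at both
    -- components of the last slot.
    set K : (Fin n → A × A) → A → ℝ≥0∞ := fun d a => N d a / G n d with hK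
    have mK : Measurable (Function.uncurry K) := mN.div ((mG n).comp measurable_fst)
    have Gtop : ∀ d, G n d ≠ ∞ := fun d => ((leG n d).trans_lt ENNReal.one_lt_top).ne
    have posN : ∀ d a, 0 < N d a := fun d a =>
      lintegral_pos_of_pos ((measurable_seqLik_mul m1 hψ hX n d).comp
        (by fun_prop : Measurable fun θ : Θ => (θ, a)))
        fun θ => ENNReal.mul_pos (seqLik_pos pos1 _ _).ne' (hψ0 _).ne'
    have posK : ∀ d a, 0 < K d a := fun d a => ENNReal.div_pos (posN d a).ne' (Gtop d)
    have leK : ∀ d a, K d a ≤ 1 := fun d a =>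
      ENNReal.div_le_of_le_mul (by
        rw [one_mul]
        exact lintegral_mono fun θ => mul_le_of_le_one_right' (hψ1 _))
    have intK : ∀ d, ∫⁻ a, K d a ∂α = 1 := by
      intro d
      have hm : Measurable (N d) := mN.comp (by fun_prop : Measurable fun a => (d, a))
      simp only [hK, div_eq_mul_inv]
      rw [lintegral_mul_const _ hm, lintegral_mixNext m1 hψ hX hint]
      exact ENNReal.mul_inv_cancel (posG n d).ne' (Gtop d)
    have Gsucc : ∀ d : Fin (n + 1) → A × A,
        G (n + 1) d = G n (Fin.init d) * K (Fin.init d) (pr (d (Fin.last n))) := fun d =>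
      (ENNReal.mul_div_cancel (posG n _).ne' (Gtop _)).symm
    have mKpr : ∀ {p : A × A → A}, Measurable p →
        Measurable fun d : Fin (n + 1) → A × A => K (Fin.init d) (p (d (Fin.last n))) := by
      intro p hp
      exact mK.comp (((measurable_init n)).prodMk (hp.comp (measurable_pi_apply _)))
    -- The comparison density keeps the true law of the past and draws both new observations
    -- independently from `K`. One use of Gibbs' inequality then does two things: it separates the
    -- two observations and replaces the conditioning on both halves by the weaker one.
    set Q : (Fin (n + 1) → A × A) → ℝ≥0∞ := fun d => T n (Fin.init d) *
      (K (Fin.init d) (d (Fin.last n)).1 * K (Fin.init d) (d (Fin.last n)).2) with hQ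
    have mQ : Measurable Q :=
      ((mT n).comp (measurable_init n)).mul ((mKpr measurable_fst).mul (mKpr measurable_snd))
    have intQ : ∫⁻ d, Q d ∂(Measure.pi fun _ : Fin (n + 1) => α.prod α) = 1 := by
      have := lintegral_init_last (κ := α.prod α) n
        (F := fun d a => T n d * (K d a.1 * K d a.2)) (by
          have h1 : Measurable fun q : (Fin n → A × A) × (A × A) => K q.1 q.2.1 :=
            mK.comp (by fun_prop : Measurable fun q : (Fin n → A × A) × (A × A) => (q.1, q.2.1))
          have h2 : Measurable fun q : (Fin n → A × A) × (A × A) => K q.1 q.2.2 :=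
            mK.comp (by fun_prop : Measurable fun q : (Fin n → A × A) × (A × A) => (q.1, q.2.2))
          exact ((mT n).comp measurable_fst).mul (h1.mul h2))
      refine this.trans ?_
      rw [← totT n]
      refine lintegral_congr fun d => ?_
      have hm : Measurable (K d) := mK.comp (by fun_prop : Measurable fun a => (d, a))
      have hm2 : Measurable fun a : A × A => K d a.1 * K d a.2 :=
        (hm.comp measurable_fst).mul (hm.comp measurable_snd)
      rw [lintegral_const_mul _ hm2,
        lintegral_prod_mul hm.aemeasurable hm.aemeasurable, intK, one_mul, mul_one]
    have gibbs := lintegral_negLog_le (ρ := Measure.pi fun _ : Fin (n + 1) => α.prod α)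
      (mT (n + 1)) mQ (posT _) (leT _)
      (fun d => ENNReal.mul_pos (posT _ _).ne' (ENNReal.mul_pos (posK _ _).ne' (posK _ _).ne').ne')
      (fun d => mul_le_one' (leT _ _) (mul_le_one' (leK _ _) (leK _ _)))
      (by rw [totT]; simp) (by rw [totT, intQ])
    have split : ∀ d, T (n + 1) d * negLog (Q d) = T (n + 1) d * negLog (T n (Fin.init d)) +
        (T (n + 1) d * negLog (K (Fin.init d) (d (Fin.last n)).1) +
          T (n + 1) d * negLog (K (Fin.init d) (d (Fin.last n)).2)) := by
      intro d
      rw [hQ, negLog_mul (posT _ _) (leT _ _)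
        (ENNReal.mul_pos (posK _ _).ne' (posK _ _).ne') (mul_le_one' (leK _ _) (leK _ _)),
        negLog_mul (posK _ _) (leK _ _) (posK _ _) (leK _ _), mul_add, mul_add]
    set E : (A × A → A) → ℝ≥0∞ := fun p =>
      ∫⁻ d, T (n + 1) d * negLog (K (Fin.init d) (p (d (Fin.last n))))
        ∂(Measure.pi fun _ : Fin (n + 1) => α.prod α) with hE
    -- Given `θ` and the past, both observations of the last slot have the density `ψ` for the same
    -- input, so under `T` they are exchangeable. The cross entropies of the two halves against `K`
    -- agree.
    have hsymm : E Prod.fst = E Prod.snd := by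
      have key : ∀ p : A × A → A, Measurable p → E p =
          ∫⁻ d, ∫⁻ a, mixNext ψ2 ψ2 X lam n d a * negLog (K d (p a)) ∂(α.prod α)
            ∂(Measure.pi fun _ : Fin n => α.prod α) := by
        intro p hp
        refine lintegral_init_last (κ := α.prod α) n
          (F := fun d a => mixNext ψ2 ψ2 X lam n d a * negLog (K d (p a))) ?_
        have h1 : Measurable fun q : (Fin n → A × A) × (A × A) => K q.1 (p q.2) :=
          mK.comp (by fun_prop : Measurable fun q : (Fin n → A × A) × (A × A) => (q.1, p q.2))
        exact (measurable_mixNext m2 m2 hX n).mul (measurable_negLog.comp h1)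
      rw [key _ measurable_fst, key _ measurable_snd]
      refine lintegral_congr fun d => ?_
      rw [← lintegral_prod_swap]
      refine lintegral_congr fun a => ?_
      have : mixNext ψ2 ψ2 X lam n d a.swap = mixNext ψ2 ψ2 X lam n d a := by
        refine lintegral_congr fun θ => ?_
        simp only [hψ2, Prod.fst_swap, Prod.snd_swap]
        rw [mul_comm (ψ (_, a.2))]
      rw [this]; rfl
    have hEpr : E Prod.fst + E Prod.snd = 2 * E pr := by
      rcases hpr with rfl | rfl
      · rw [← hsymm, two_mul]
      · rw [hsymm, two_mul]
    have mnT : Measurable fun d => negLog (T n d) := measurable_negLog.comp (mT n)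
    have mnG : Measurable fun d => negLog (G n d) := measurable_negLog.comp (mG n)
    have mTn : Measurable fun d => T (n + 1) d * negLog (T n (Fin.init d)) :=
      (mT _).mul (mnT.comp (measurable_init n))
    have mGn : Measurable fun d => T (n + 1) d * negLog (G n (Fin.init d)) :=
      (mT _).mul (mnG.comp (measurable_init n))
    have mE1 : Measurable fun d : Fin (n + 1) → A × A =>
        T (n + 1) d * negLog (K (Fin.init d) (d (Fin.last n)).1) :=
      (mT _).mul (measurable_negLog.comp (mKpr measurable_fst))
    calc _ ≤ _ := gibbs
      _ = ∫⁻ d, T n d * negLog (T n d) ∂(Measure.pi fun _ : Fin n => α.prod α) + 2 * E pr := by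
        rw [lintegral_congr split, lintegral_add_left mTn, lintegral_add_left mE1,
          marg n (fun d => negLog (T n d)) mnT, ← hEpr]
      _ ≤ 2 * ∫⁻ d, T n d * negLog (G n d) ∂(Measure.pi fun _ : Fin n => α.prod α) + 2 * E pr := by
        gcongr
      -- The chain rule for the selected half, `G (n + 1) = G n * K`, absorbs the term `E pr` and
      -- closes the induction.
      _ = _ := by
        rw [← mul_add, ← marg n (fun d => negLog (G n d)) mnG, ← lintegral_add_left mGn]
        congr 1
        refine lintegral_congr fun d => ?_
        rw [Gsucc, negLog_mul (posG _ _) (leG _ _) (posK _ _) (leK _ _), mul_add]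

end Doubling

end Sequential

/-! ### Output entropy, conditional entropy and mutual information -/

section Channel

variable {W O : Type*} [MeasurableSpace W] [MeasurableSpace O]

/-- The density of the output of a channel with transition density `f` and input law `τ`. -/
def outDens (τ : Measure W) (f : W × O → ℝ≥0∞) (o : O) : ℝ≥0∞ := ∫⁻ w, f (w, o) ∂τ

/-- The conditional entropy of the output given the input. -/
def condEnt (τ : Measure W) (ρ : Measure O) (f : W × O → ℝ≥0∞) : ℝ≥0∞ :=
  ∫⁻ p, f p * negLog (f p) ∂(τ.prod ρ)

/-- The entropy of the output. -/
def outEnt (τ : Measure W) (ρ : Measure O) (f : W × O → ℝ≥0∞) : ℝ≥0∞ :=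
  ∫⁻ p, f p * negLog (outDens τ f p.2) ∂(τ.prod ρ)

variable {τ : Measure W} [IsProbabilityMeasure τ] {ρ : Measure O} [SFinite ρ] {f : W × O → ℝ≥0∞}

@[fun_prop]
lemma measurable_outDens (hf : Measurable f) : Measurable (outDens τ f) :=
  Measurable.lintegral_prod_left' hf

lemma outDens_pos (hf : Measurable f) (h0 : ∀ p, 0 < f p) (o : O) : 0 < outDens τ f o :=
  lintegral_pos_of_pos (hf.comp (by fun_prop)) fun _ => h0 _

lemma outDens_le_one (h1 : ∀ p, f p ≤ 1) (o : O) : outDens τ f o ≤ 1 :=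
  lintegral_le_one_of_le_one fun _ => h1 _

lemma lintegral_prod_eq_one (hf : Measurable f) (hint : ∀ w, ∫⁻ o, f (w, o) ∂ρ = 1) :
    ∫⁻ p, f p ∂(τ.prod ρ) = 1 := by
  rw [lintegral_prod _ hf.aemeasurable]
  simp [hint]

lemma lintegral_mul_comp_snd (hf : Measurable f) {F : O → ℝ≥0∞} (hF : Measurable F) :
    ∫⁻ p, f p * F p.2 ∂(τ.prod ρ) = ∫⁻ o, outDens τ f o * F o ∂ρ := by
  rw [lintegral_prod_symm' _ (by fun_prop)]
  refine lintegral_congr fun o => ?_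
  have hm : Measurable fun w => f (w, o) := by fun_prop
  exact lintegral_mul_const (μ := τ) (F o) hm

lemma lintegral_outDens (hf : Measurable f) (hint : ∀ w, ∫⁻ o, f (w, o) ∂ρ = 1) :
    ∫⁻ o, outDens τ f o ∂ρ = 1 := by
  rw [← lintegral_prod_eq_one (τ := τ) hf hint]
  simpa using (lintegral_mul_comp_snd (τ := τ) (ρ := ρ) hf (F := fun _ => 1) measurable_const).symm

lemma outEnt_eq (hf : Measurable f) :
    outEnt τ ρ f = ∫⁻ o, outDens τ f o * negLog (outDens τ f o) ∂ρ :=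
  lintegral_mul_comp_snd hf (F := fun o => negLog (outDens τ f o)) (by fun_prop)

/-- Gibbs' inequality on the product space, with the output density as a comparison density that
ignores the input. It serves to make conditional entropies finite. -/
lemma condEnt_le_outEnt (hf : Measurable f) (h0 : ∀ p, 0 < f p) (h1 : ∀ p, f p ≤ 1)
    (hint : ∀ w, ∫⁻ o, f (w, o) ∂ρ = 1) : condEnt τ ρ f ≤ outEnt τ ρ f := by
  have e1 := lintegral_prod_eq_one (τ := τ) hf hint
  refine lintegral_negLog_le hf (by fun_prop) h0 h1 (fun _ => outDens_pos hf h0 _)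
    (fun _ => outDens_le_one h1 _) (by rw [e1]; simp) ?_
  rw [e1, lintegral_prod _ (by fun_prop)]
  simp [lintegral_outDens hf hint]

/-- The entropy of the output is at most the cross entropy with respect to any density. -/
lemma outEnt_le_crossEnt (hf : Measurable f) (h0 : ∀ p, 0 < f p) (h1 : ∀ p, f p ≤ 1)
    (hint : ∀ w, ∫⁻ o, f (w, o) ∂ρ = 1) {q : O → ℝ≥0∞} (hq : Measurable q) (hq0 : ∀ o, 0 < q o)
    (hq1 : ∀ o, q o ≤ 1) (hqint : ∫⁻ o, q o ∂ρ ≤ 1) :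
    outEnt τ ρ f ≤ ∫⁻ p, f p * negLog (q p.2) ∂(τ.prod ρ) := by
  have e1 := lintegral_outDens (τ := τ) hf hint
  rw [outEnt_eq hf, lintegral_mul_comp_snd hf (F := fun o => negLog (q o)) (by fun_prop)]
  exact lintegral_negLog_le (measurable_outDens hf) hq (outDens_pos hf h0) (outDens_le_one h1)
    hq0 hq1 (by rw [e1]; simp) (by rwa [e1])

/-- The entropy of the output is the conditional entropy plus the mutual information. -/
lemma outEnt_le_condEnt_add_klDiv (hf : Measurable f) (h0 : ∀ p, 0 < f p) (h1 : ∀ p, f p ≤ 1)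
    (hint : ∀ w, ∫⁻ o, f (w, o) ∂ρ = 1) (hfin : outEnt τ ρ f ≠ ∞) [SigmaFinite ρ] :
    outEnt τ ρ f ≤ condEnt τ ρ f + InformationTheory.klDiv ((τ.prod ρ).withDensity f)
      (τ.prod (ρ.withDensity (outDens τ f))) := by
  have mg : Measurable (outDens τ f) := measurable_outDens hf
  have ft : ∀ p, f p ≠ ∞ := fun p => ((h1 p).trans_lt ENNReal.one_lt_top).ne
  have gt : ∀ o, outDens τ f o ≠ ∞ := fun o =>
    ((outDens_le_one h1 o).trans_lt ENNReal.one_lt_top).ne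
  have hcfin : condEnt τ ρ f ≠ ∞ :=
    ((condEnt_le_outEnt hf h0 h1 hint).trans_lt hfin.lt_top).ne
  have : IsProbabilityMeasure ((τ.prod ρ).withDensity f) :=
    ⟨by rw [withDensity_apply _ .univ, setLIntegral_univ, lintegral_prod_eq_one hf hint]⟩
  have : IsProbabilityMeasure (ρ.withDensity (outDens τ f)) :=
    ⟨by rw [withDensity_apply _ .univ, setLIntegral_univ, lintegral_outDens hf hint]⟩
  set J := (τ.prod ρ).withDensity f with hJ
  set Q := τ.prod (ρ.withDensity (outDens τ f)) with hQ
  have hQ' : Q = (τ.prod ρ).withDensity (fun p => outDens τ f p.2) := by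
    rw [hQ, prod_withDensity_right mg]
  have mr : Measurable fun p : W × O => f p / outDens τ f p.2 := by fun_prop
  -- The joint law has density `f / outDens` with respect to the product of the marginals, so the
  -- log-likelihood ratio is a difference of two `negLog` terms, integrable because both entropies
  -- are finite.
  have hJQ : J = Q.withDensity (fun p => f p / outDens τ f p.2) := by
    rw [hQ', ← withDensity_mul _ (by fun_prop) mr, hJ]
    congr 1
    ext p
    exact (ENNReal.mul_div_cancel (outDens_pos hf h0 _).ne' (gt _)).symm
  have hac : J ≪ Q := hJQ ▸ withDensity_absolutelyContinuous _ _
  have hllr : llr J Q =ᵐ[J] fun p =>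
      (negLog (outDens τ f p.2)).toReal - (negLog (f p)).toReal := by
    have h := hac.ae_le (Measure.rnDeriv_withDensity Q mr)
    rw [← hJQ] at h
    filter_upwards [h] with p hp
    rw [llr, hp, toReal_negLog (h1 p), toReal_negLog (outDens_le_one h1 _), ENNReal.toReal_div,
      Real.log_div (toReal_mem_of_pos_le_one (h0 _) (h1 _)).1.ne'
      (toReal_mem_of_pos_le_one (outDens_pos hf h0 _) (outDens_le_one h1 _)).1.ne']
    ring
  have l1 : ∫⁻ p, negLog (outDens τ f p.2) ∂J = outEnt τ ρ f :=
    lintegral_withDensity_eq_lintegral_mul _ hf (by fun_prop)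
  have l2 : ∫⁻ p, negLog (f p) ∂J = condEnt τ ρ f :=
    lintegral_withDensity_eq_lintegral_mul _ hf (by fun_prop)
  have i1 : Integrable (fun p => (negLog (outDens τ f p.2)).toReal) J :=
    integrable_toReal_of_lintegral_ne_top (by fun_prop) (by rwa [l1])
  have i2 : Integrable (fun p => (negLog (f p)).toReal) J :=
    integrable_toReal_of_lintegral_ne_top (by fun_prop) (by rwa [l2])
  have illr : Integrable (llr J Q) J := (integrable_congr hllr).2 (i1.sub i2)
  rw [InformationTheory.klDiv_of_ac_of_integrable hac illr, integral_congr_ae hllr,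
    integral_sub i1 i2, integral_toReal (by fun_prop) (by simp [negLog]),
    integral_toReal (by fun_prop) (by simp [negLog]), l1, l2]
  -- The divergence of finite measures contains the difference of their masses, which vanishes for
  -- probability measures. The truncated subtraction that remains is harmless, since `a ≤ b + (a -
  -- b)` always holds.
  simp only [probReal_univ, add_sub_cancel_right]
  rw [ENNReal.ofReal_sub _ ENNReal.toReal_nonneg, ENNReal.ofReal_toReal hfin,
    ENNReal.ofReal_toReal hcfin]
  exact le_add_tsub

end Channel

/-! ### Fano's inequality -/

section Fano

variable {m : ℕ} [NeZero m] {O : Type*} [MeasurableSpace O] {ρ : Measure O} [SFinite ρ]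
  {f : Fin m × O → ℝ≥0∞}

lemma uniformOn_univ_singleton (w : Fin m) :
    ProbabilityTheory.uniformOn (Set.univ : Set (Fin m)) {w} = (m : ℝ≥0∞)⁻¹ := by
  rw [ProbabilityTheory.uniformOn_univ]; simp

/-- Fano's inequality. -/
lemma log_add_condEnt_le (hf : Measurable f) (h0 : ∀ p, 0 < f p) (h1 : ∀ p, f p ≤ 1)
    (hint : ∀ w, ∫⁻ o, f (w, o) ∂ρ = 1) {dec : O → Fin m} (hdec : Measurable dec) :
    ENNReal.ofReal (Real.log m) + condEnt (ProbabilityTheory.uniformOn Set.univ) ρ f ≤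
      outEnt (ProbabilityTheory.uniformOn Set.univ) ρ f + (ENNReal.ofReal (Real.log 2) +
        ENNReal.ofReal (Real.log m) * ∫⁻ p, f p * Set.indicator {p | dec p.2 ≠ p.1} 1 p
          ∂((ProbabilityTheory.uniformOn Set.univ).prod ρ)) := by
  set τ : Measure (Fin m) := ProbabilityTheory.uniformOn Set.univ with hτ
  have hm0 : (m : ℝ≥0∞) ≠ 0 := by simpa using NeZero.ne m
  have hmt : (m : ℝ≥0∞) ≠ ∞ := ENNReal.natCast_ne_top m
  have hm1 : (m : ℝ≥0∞)⁻¹ ≤ 1 := by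
    rw [ENNReal.inv_le_one]; exact_mod_cast NeZero.one_le
  have hmi0 : 0 < (m : ℝ≥0∞)⁻¹ := ENNReal.inv_pos.2 hmt
  have nlm : negLog (m : ℝ≥0∞)⁻¹ = ENNReal.ofReal (Real.log m) := by
    simp [negLog, ENNReal.toReal_inv]
  have nl2 : negLog (2 : ℝ≥0∞)⁻¹ = ENNReal.ofReal (Real.log 2) := by
    simp [negLog, ENNReal.toReal_inv]
  have h21 : (2 : ℝ≥0∞)⁻¹ ≤ 1 := by rw [ENNReal.inv_le_one]; norm_num
  have h20 : (0 : ℝ≥0∞) < 2⁻¹ := by simp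
  have mS : MeasurableSet {p : Fin m × O | dec p.2 ≠ p.1} :=
    (measurableSet_eq_fun (hdec.comp measurable_snd) measurable_fst).compl
  classical
  -- The comparison law guesses the decoded message with weight 1/2 and spreads the rest over all
  -- messages: `R` is 1 at the decoded message and `1 / m` elsewhere. Its negative logarithm is `log
  -- m` exactly on the error event, and the factor 1/2 costs `log 2`.
  set R : Fin m × O → ℝ≥0∞ := fun p => if dec p.2 ≠ p.1 then (m : ℝ≥0∞)⁻¹ else 1 with hR
  have mR : Measurable R := Measurable.ite mS measurable_const measurable_const
  have R0 : ∀ p, 0 < R p := fun p => by simp only [hR]; split_ifs <;> simp [hmi0]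
  have R1 : ∀ p, R p ≤ 1 := fun p => by simp only [hR]; split_ifs <;> simp [hm1]
  have mg : Measurable (outDens τ f) := measurable_outDens hf
  have g0 := outDens_pos (τ := τ) hf h0
  have g1 := outDens_le_one (τ := τ) h1
  set q : Fin m × O → ℝ≥0∞ := fun p => outDens τ f p.2 * (2⁻¹ * R p) with hq
  -- Both densities are scaled by `1 / m`, which keeps the comparison density below 1. On the left,
  -- the scaling produces the term `log m`.
  set p' : Fin m × O → ℝ≥0∞ := fun p => f p * (m : ℝ≥0∞)⁻¹ with hp'
  have intp' : ∫⁻ p, p' p ∂(τ.prod ρ) = (m : ℝ≥0∞)⁻¹ := by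
    rw [hp', lintegral_mul_const _ hf, lintegral_prod_eq_one hf hint, one_mul]
  have intR : ∀ o, ∫⁻ w, 2⁻¹ * R (w, o) ∂τ ≤ (m : ℝ≥0∞)⁻¹ := by
    intro o
    have hRle : ∀ w, R (w, o) ≤ (m : ℝ≥0∞)⁻¹ + Set.indicator {dec o} 1 w := by
      intro w
      simp only [hR]
      split_ifs with h
      · exact le_self_add
      · rw [not_not] at h
        simp [h]
    have hm : Measurable fun w => R (w, o) := by fun_prop
    rw [lintegral_const_mul _ hm]
    calc 2⁻¹ * ∫⁻ w, R (w, o) ∂τ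
        ≤ 2⁻¹ * ∫⁻ w, ((m : ℝ≥0∞)⁻¹ + Set.indicator {dec o} 1 w) ∂τ := by
          gcongr; exact hRle _
      _ = 2⁻¹ * ((m : ℝ≥0∞)⁻¹ + (m : ℝ≥0∞)⁻¹) := by
          rw [lintegral_add_left measurable_const, lintegral_indicator_one (measurableSet_singleton _),
            uniformOn_univ_singleton]
          simp
      _ = (m : ℝ≥0∞)⁻¹ := by
          rw [← two_mul, ← mul_assoc, ENNReal.inv_mul_cancel two_ne_zero (by simp), one_mul]
  have intq : ∫⁻ p, q p ∂(τ.prod ρ) ≤ (m : ℝ≥0∞)⁻¹ := by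
    rw [lintegral_prod_symm' _ (by fun_prop)]
    calc ∫⁻ o, ∫⁻ w, outDens τ f o * (2⁻¹ * R (w, o)) ∂τ ∂ρ
        ≤ ∫⁻ o, outDens τ f o * (m : ℝ≥0∞)⁻¹ ∂ρ := by
          refine lintegral_mono fun o => ?_
          have hm : Measurable fun w => 2⁻¹ * R (w, o) := by fun_prop
          rw [lintegral_const_mul _ hm]
          gcongr
          exact intR o
      _ = _ := by rw [lintegral_mul_const _ mg, lintegral_outDens hf hint, one_mul]
  have gibbs := lintegral_negLog_le (ρ := τ.prod ρ) (p := p') (q := q) (by fun_prop) (by fun_prop)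
    (fun p => ENNReal.mul_pos (h0 _).ne' hmi0.ne') (fun p => mul_le_one' (h1 _) hm1)
    (fun p => ENNReal.mul_pos (g0 _).ne' (ENNReal.mul_pos h20.ne' (R0 _).ne').ne')
    (fun p => mul_le_one' (g1 _) (mul_le_one' h21 (R1 _)))
    (by rw [intp']; exact ENNReal.inv_ne_top.2 hm0) (by rw [intp']; exact intq)
  have e1 : ∀ p, p' p * negLog (p' p) =
      (m : ℝ≥0∞)⁻¹ * (f p * negLog (f p) + f p * ENNReal.ofReal (Real.log m)) := by
    intro p
    rw [hp', negLog_mul (h0 p) (h1 p) hmi0 hm1, nlm]; ring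
  have nR : ∀ p, negLog (R p) =
      ENNReal.ofReal (Real.log m) * Set.indicator {p | dec p.2 ≠ p.1} 1 p := by
    intro p
    by_cases h : dec p.2 ≠ p.1
    · rw [Set.indicator_of_mem (by exact h)]; simp [hR, h, nlm]
    · rw [Set.indicator_of_notMem (by exact h)]; simp only [hR, if_neg h]; simp
  have e2 : ∀ p, p' p * negLog (q p) = (m : ℝ≥0∞)⁻¹ * (f p * negLog (outDens τ f p.2) +
      (f p * ENNReal.ofReal (Real.log 2) + ENNReal.ofReal (Real.log m) *
        (f p * Set.indicator {p | dec p.2 ≠ p.1} 1 p))) := by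
    intro p
    rw [hp', hq, negLog_mul (g0 _) (g1 _) (ENNReal.mul_pos h20.ne' (R0 _).ne')
      (mul_le_one' h21 (R1 _)), negLog_mul h20 h21 (R0 _) (R1 _), nl2, nR]
    ring
  have mI : Measurable (Set.indicator {p : Fin m × O | dec p.2 ≠ p.1} (1 : Fin m × O → ℝ≥0∞)) :=
    measurable_one.indicator mS
  rw [lintegral_congr e1, lintegral_congr e2, lintegral_const_mul _ (by fun_prop),
    lintegral_const_mul _ (by fun_prop), ENNReal.mul_le_mul_iff_right hmi0.ne'
    (ENNReal.inv_ne_top.2 hm0), lintegral_add_right _ (by fun_prop), lintegral_mul_const _ hf,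
    lintegral_prod_eq_one hf hint, one_mul, lintegral_add_left (by fun_prop),
    lintegral_add_left (by fun_prop), lintegral_mul_const _ hf, lintegral_prod_eq_one hf hint,
    one_mul, lintegral_const_mul _ (by fun_prop)] at gibbs
  rw [add_comm]
  exact gibbs

end Fano

/-! ### Complex Gaussian densities -/

/-- The density of the circularly symmetric complex Gaussian law of mean `0` and variance `s`. -/
def cgDens (s : ℝ) (z : ℂ) : ℝ≥0∞ :=
  ENNReal.ofReal ((Real.pi * s)⁻¹ * Real.exp (-(‖z‖ ^ 2 / s)))

@[fun_prop]
lemma measurable_cgDens : Measurable (Function.uncurry cgDens) := by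
  unfold cgDens
  fun_prop

lemma cgDens_pos {s : ℝ} (hs : 0 < s) (z : ℂ) : 0 < cgDens s z := by
  unfold cgDens
  have := Real.pi_pos
  exact ENNReal.ofReal_pos.2 (by positivity)

/-- The peak value is `1 / (π s)`. This is the source of all bounds of densities by 1. -/
lemma cgDens_le_one {s : ℝ} (hs : 1 ≤ s) (z : ℂ) : cgDens s z ≤ 1 := by
  unfold cgDens
  rw [ENNReal.ofReal_le_one]
  have hpi := Real.pi_gt_three
  refine mul_le_one₀ (inv_le_one_of_one_le₀ (by nlinarith)) (Real.exp_pos _).le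
    (Real.exp_le_one_iff.2 ?_)
  have : 0 ≤ ‖z‖ ^ 2 / s := by positivity
  linarith

/-- Stated for every variance, because the normalization of `cgDens s` is read off from it as well
as the density of the noise. -/
lemma map_gaussianReal_prod {s : ℝ≥0} (hs : s ≠ 0) :
    ((ProbabilityTheory.gaussianReal 0 (s / 2)).prod
      (ProbabilityTheory.gaussianReal 0 (s / 2))).map Complex.measurableEquivRealProd.symm =
      volume.withDensity (cgDens s) := by
  have hs2 : s / 2 ≠ 0 := by positivity
  have mc : Measurable (cgDens s) := measurable_cgDens.comp (by fun_prop : Measurable fun z => ((s : ℝ), z))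
  refine Measure.ext_of_lintegral _ fun F hF => ?_
  have mg : Measurable fun z : ℝ × ℝ => ProbabilityTheory.gaussianPDF 0 (s / 2) z.1 *
      ProbabilityTheory.gaussianPDF 0 (s / 2) z.2 :=
    ((ProbabilityTheory.measurable_gaussianPDF _ _).comp measurable_fst).mul
      ((ProbabilityTheory.measurable_gaussianPDF _ _).comp measurable_snd)
  have mFe : Measurable fun p => F (Complex.measurableEquivRealProd.symm p) :=
    hF.comp (MeasurableEquiv.measurable _)
  rw [lintegral_map hF (MeasurableEquiv.measurable _),
    lintegral_withDensity_eq_lintegral_mul _ mc hF,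
    ProbabilityTheory.gaussianReal_of_var_ne_zero _ hs2,
    prod_withDensity (ProbabilityTheory.measurable_gaussianPDF _ _)
      (ProbabilityTheory.measurable_gaussianPDF _ _),
    lintegral_withDensity_eq_lintegral_mul _
      mg mFe,
    ← Complex.volume_preserving_equiv_real_prod.symm.lintegral_comp_emb
      (MeasurableEquiv.measurableEmbedding _)]
  refine lintegral_congr fun p => ?_
  simp only [Pi.mul_apply]
  congr 1
  have hs0 : (0 : ℝ) < s := by positivity
  rw [ProbabilityTheory.gaussianPDF, ProbabilityTheory.gaussianPDF, ← ENNReal.ofReal_mul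
    (ProbabilityTheory.gaussianPDFReal_nonneg _ _ _), cgDens]
  congr 1
  simp only [ProbabilityTheory.gaussianPDFReal, sub_zero, NNReal.coe_div, NNReal.coe_ofNat]
  have e1 : 2 * Real.pi * ((s : ℝ) / 2) = Real.pi * s := by ring
  have e2 : 2 * ((s : ℝ) / 2) = s := by ring
  have e3 : ‖Complex.measurableEquivRealProd.symm p‖ ^ 2 = p.1 ^ 2 + p.2 ^ 2 := by
    rw [Complex.sq_norm, Complex.normSq_apply]
    simp [Complex.measurableEquivRealProd, sq]
  rw [e1, e2, e3, mul_mul_mul_comm, ← Real.exp_add, ← mul_inv,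
    Real.mul_self_sqrt (by positivity)]
  congr 2
  ring

instance : IsProbabilityMeasure stdComplexGaussian :=
  Measure.isProbabilityMeasure_map (MeasurableEquiv.measurable _).aemeasurable

lemma lintegral_cgDens {s : ℝ} (hs : 0 < s) : ∫⁻ z, cgDens s z = 1 := by
  lift s to ℝ≥0 using hs.le
  have hs' : s ≠ 0 := by rintro rfl; simp at hs
  have h := map_gaussianReal_prod hs'
  have h2 := congrArg (fun μ => μ Set.univ) h
  simp only [withDensity_apply _ MeasurableSet.univ, setLIntegral_univ] at h2
  rw [← h2, Measure.map_apply (MeasurableEquiv.measurable _) .univ]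
  simp

lemma stdComplexGaussian_eq : stdComplexGaussian = volume.withDensity (cgDens 1) := by
  have := map_gaussianReal_prod (s := 1) one_ne_zero
  simpa [stdComplexGaussian] using this

lemma lintegral_pi_prod {D : Type*} [MeasurableSpace D] {κ : Measure D} [SigmaFinite κ] {n : ℕ}
    (f : Fin n → D → ℝ≥0∞) (hf : ∀ i, Measurable (f i)) :
    ∫⁻ d, ∏ i, f i (d i) ∂(Measure.pi fun _ : Fin n => κ) = ∏ i, ∫⁻ a, f i a ∂κ := by
  induction n with
  | zero => simp
  | succ n ih =>
    have hm : Measurable fun d : Fin n → D => ∏ i, f (Fin.castSucc i) (d i) :=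
      Finset.measurable_prod _ fun i _ => (hf _).comp (measurable_pi_apply i)
    have := lintegral_init_last (κ := κ) n
      (F := fun d a => (∏ i, f (Fin.castSucc i) (d i)) * f (Fin.last n) a)
      ((hm.comp measurable_fst).mul ((hf _).comp measurable_snd))
    simp only [Fin.prod_univ_castSucc]
    refine this.trans ?_
    simp_rw [lintegral_const_mul _ (hf (Fin.last n))]
    rw [lintegral_mul_const _ hm, ih _ fun i => hf _]

lemma pi_withDensity {D : Type*} [MeasurableSpace D] {κ : Measure D} [SigmaFinite κ] {n : ℕ}
    {φ : D → ℝ≥0∞} (hφ : Measurable φ) [SigmaFinite (κ.withDensity φ)] :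
    (Measure.pi fun _ : Fin n => κ.withDensity φ) =
      (Measure.pi fun _ : Fin n => κ).withDensity fun d => ∏ i, φ (d i) := by
  refine Measure.pi_eq fun s hs => ?_
  rw [withDensity_apply _ (MeasurableSet.univ_pi hs), ← lintegral_indicator (MeasurableSet.univ_pi hs)]
  simp_rw [withDensity_apply _ (hs _), ← lintegral_indicator (hs _)]
  rw [← lintegral_pi_prod _ fun i => hφ.indicator (hs i)]
  refine lintegral_congr fun d => ?_
  by_cases h : d ∈ Set.univ.pi s
  · rw [Set.indicator_of_mem h]
    exact Finset.prod_congr rfl fun i _ => (Set.indicator_of_mem (h i trivial) _).symm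
  · rw [Set.indicator_of_notMem h]
    simp only [Set.mem_pi, Set.mem_univ, true_implies, not_forall] at h
    obtain ⟨i, hi⟩ := h
    exact (Finset.prod_eq_zero (Finset.mem_univ i) (Set.indicator_of_notMem hi _)).symm

/-- The law of a Gaussian noise vector added to `c` has density `∏ t, cgDens 1 (v t - c t)`. -/
lemma lintegral_add_noise {n : ℕ} (c : Fin n → ℂ) {G : (Fin n → ℂ) → ℝ≥0∞} (hG : Measurable G) :
    ∫⁻ e, G (fun t => c t + e t) ∂(Measure.pi fun _ : Fin n => stdComplexGaussian) =
      ∫⁻ v, (∏ t, cgDens 1 (v t - c t)) * G v := by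
  have mc : Measurable (cgDens 1) := measurable_cgDens.comp (by fun_prop : Measurable fun z => ((1 : ℝ), z))
  have inst : IsProbabilityMeasure (volume.withDensity (cgDens 1)) :=
    stdComplexGaussian_eq ▸ inferInstance
  have hm : Measurable fun v : Fin n → ℂ => ∏ t, cgDens 1 (v t) :=
    Finset.measurable_prod _ fun i _ => mc.comp (measurable_pi_apply i)
  have mG : Measurable fun e : Fin n → ℂ => G fun t => c t + e t :=
    hG.comp (measurable_pi_lambda _ fun t => (measurable_pi_apply t).const_add _)
  rw [stdComplexGaussian_eq, pi_withDensity mc, lintegral_withDensity_eq_lintegral_mul _ hm mG,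
    ← volume_pi, ← lintegral_sub_right_eq_self _ c]
  simp

/-- Any finite constant would do. From `t ≤ 2 exp (t / 2)` at `t = ‖z‖ ^ 2`, the integrand is at
most 4 times the density of variance 2. -/
lemma lintegral_sq_norm_stdComplexGaussian :
    ∫⁻ z, ENNReal.ofReal (‖z‖ ^ 2) ∂stdComplexGaussian ≤ 4 := by
  have m : Measurable fun z : ℂ => ENNReal.ofReal (‖z‖ ^ 2) := by fun_prop
  have mc : ∀ s : ℝ, Measurable (cgDens s) := fun s =>
    measurable_cgDens.comp (by fun_prop : Measurable fun z => (s, z))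
  rw [stdComplexGaussian_eq, lintegral_withDensity_eq_lintegral_mul _ (mc 1) m]
  calc ∫⁻ z, (cgDens 1 * fun z : ℂ => ENNReal.ofReal (‖z‖ ^ 2)) z
      ≤ ∫⁻ z, 4 * cgDens 2 z := by
        refine lintegral_mono fun z => ?_
        simp only [Pi.mul_apply, cgDens]
        rw [← ENNReal.ofReal_mul (by positivity), show (4 : ℝ≥0∞) = ENNReal.ofReal 4 by simp,
          ← ENNReal.ofReal_mul (by norm_num)]
        refine ENNReal.ofReal_le_ofReal ?_
        have h := Real.add_one_le_exp (‖z‖ ^ 2 / 2)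
        have he : Real.exp (-(‖z‖ ^ 2 / 1)) * Real.exp (‖z‖ ^ 2 / 2) =
            Real.exp (-(‖z‖ ^ 2 / 2)) := by rw [← Real.exp_add]; congr 1; ring
        rw [← he]
        have hpi := Real.pi_pos
        calc (Real.pi * 1)⁻¹ * Real.exp (-(‖z‖ ^ 2 / 1)) * ‖z‖ ^ 2
            ≤ (Real.pi * 1)⁻¹ * Real.exp (-(‖z‖ ^ 2 / 1)) * (2 * Real.exp (‖z‖ ^ 2 / 2)) := by
              gcongr
              linarith
          _ = _ := by field_simp; ring
    _ = 4 := by rw [lintegral_const_mul _ (mc 2), lintegral_cgDens two_pos, mul_one]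

section Swap

variable {α β : Type*} [MeasurableSpace α] [MeasurableSpace β] {μ : Measure α} {ν : Measure β}
  [SFinite μ] [SFinite ν]

lemma lintegral_swap_of_measurable {f : α → β → ℝ≥0∞} (hf : Measurable fun p : α × β => f p.1 p.2) :
    ∫⁻ x, ∫⁻ y, f x y ∂ν ∂μ = ∫⁻ y, ∫⁻ x, f x y ∂μ ∂ν :=
  lintegral_lintegral_swap hf.aemeasurable

end Swap

/-- Unrolls the recursion over time, to match it with the likelihoods of a code, which are products
over the time slots. -/
lemma seqLik_eq_prod {V D Θ : Type*} (ψ : V × D → ℝ≥0∞) (X : (n : ℕ) → Θ × (Fin n → D) → V) (n : ℕ)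
    (θ : Θ) (d : Fin n → D) :
    seqLik ψ X n (θ, d) =
      ∏ t : Fin n, ψ (X t (θ, fun i => d (Fin.castLE t.isLt.le i)), d t) := by
  induction n with
  | zero => rfl
  | succ n ih =>
    rw [Fin.prod_univ_castSucc]
    change seqLik ψ X n (θ, Fin.init d) * _ = _
    rw [ih]
    rfl

/-! ### Reference measures and output densities of a code -/

/-- The bilinear product `aᵀ b`. -/
def dot {M : ℕ} (a b : Vec M) : ℂ := ∑ i, a i * b i

@[fun_prop]
lemma measurable_dot {M : ℕ} : Measurable fun p : Vec M × Vec M => dot p.1 p.2 := by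
  unfold dot; fun_prop

/-- The channel vectors of both channels. -/
abbrev Chan (M n : ℕ) : Type := (Fin n → Vec M) × (Fin n → Vec M)

/-- An output together with the channel vectors. -/
abbrev Obs (M n : ℕ) : Type := (Fin n → ℂ) × Chan M n

/-- The law of the channel vectors. -/
def chanLaw {M : ℕ} (ν : Measure (Vec M)) (n : ℕ) : Measure (Chan M n) :=
  (Measure.pi fun _ : Fin n => ν).prod (Measure.pi fun _ : Fin n => ν)

/-- The reference measure for an output together with the channel vectors. -/
def obsRef {M : ℕ} (ν : Measure (Vec M)) (n : ℕ) : Measure (Obs M n) :=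
  (volume : Measure (Fin n → ℂ)).prod (chanLaw ν n)

/-- The reference measure for both outputs together with the channel vectors. -/
def jointRef {M : ℕ} (ν : Measure (Vec M)) (n : ℕ) : Measure ((Fin n → ℂ) × Obs M n) :=
  (volume : Measure (Fin n → ℂ)).prod (obsRef ν n)

section Ref

variable {M n : ℕ} {ν : Measure (Vec M)} [IsProbabilityMeasure ν]

instance : IsProbabilityMeasure (chanLaw ν n) := by unfold chanLaw; infer_instance

instance : SigmaFinite (obsRef ν n) := by unfold obsRef; infer_instance

instance : SigmaFinite (jointRef ν n) := by unfold jointRef; infer_instance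

lemma lintegral_pi_prod_eq {A B : Type*} [MeasurableSpace A] [MeasurableSpace B] {μ : Measure A}
    {κ : Measure B} [SigmaFinite μ] [SigmaFinite κ] {F : (Fin n → A) × (Fin n → B) → ℝ≥0∞}
    (hF : Measurable F) :
    ∫⁻ d, F (fun t => (d t).1, fun t => (d t).2) ∂(Measure.pi fun _ : Fin n => μ.prod κ) =
      ∫⁻ a, ∫⁻ b, F (a, b) ∂(Measure.pi fun _ : Fin n => κ) ∂(Measure.pi fun _ : Fin n => μ) := by
  rw [← lintegral_prod _ hF.aemeasurable]
  exact (measurePreserving_arrowProdEquivProdArrow A B (Fin n) (fun _ => μ)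
    (fun _ => κ)).lintegral_comp hF

/-- Collect the data of each time slot: channel vector and output of both receivers. -/
lemma lintegral_jointRef {F : (Fin n → ℂ) × Obs M n → ℝ≥0∞} (hF : Measurable F) :
    ∫⁻ o, F o ∂(jointRef ν n) =
      ∫⁻ d, F (fun t => (d t).1.2, fun t => (d t).2.2, fun t => (d t).1.1, fun t => (d t).2.1)
        ∂(Measure.pi fun _ : Fin n => (ν.prod volume).prod (ν.prod volume)) := by
  have h1 := lintegral_pi_prod_eq (n := n) (μ := ν.prod (volume : Measure ℂ))
    (κ := ν.prod (volume : Measure ℂ))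
    (F := fun p => F (fun t => (p.1 t).2, fun t => (p.2 t).2, fun t => (p.1 t).1,
      fun t => (p.2 t).1)) (by fun_prop)
  refine Eq.trans ?_ h1.symm
  have h2 : ∀ u : Fin n → Vec M × ℂ,
      ∫⁻ v, F (fun t => (u t).2, fun t => (v t).2, fun t => (u t).1, fun t => (v t).1)
        ∂(Measure.pi fun _ : Fin n => ν.prod (volume : Measure ℂ)) =
      ∫⁻ g, (∫⁻ z : Fin n → ℂ, F (fun t => (u t).2, z, fun t => (u t).1, g))
        ∂(Measure.pi fun _ : Fin n => ν) := fun u =>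
    lintegral_pi_prod_eq (n := n) (μ := ν) (κ := (volume : Measure ℂ))
      (F := fun p => F (fun t => (u t).2, p.2, fun t => (u t).1, p.1)) (by fun_prop)
  rw [lintegral_congr h2]
  have h3 := lintegral_pi_prod_eq (n := n) (μ := ν) (κ := (volume : Measure ℂ))
    (F := fun p => ∫⁻ g, (∫⁻ z : Fin n → ℂ, F (p.2, z, p.1, g)) ∂(Measure.pi fun _ : Fin n => ν))
    (by
      refine Measurable.lintegral_prod_right' (f := fun q : ((Fin n → Vec M) × (Fin n → ℂ)) ×
        (Fin n → Vec M) => ∫⁻ z : Fin n → ℂ, F (q.1.2, z, q.1.1, q.2)) ?_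
      refine Measurable.lintegral_prod_right' (f := fun q : (((Fin n → Vec M) × (Fin n → ℂ)) ×
        (Fin n → Vec M)) × (Fin n → ℂ) => F (q.1.1.2, q.2, q.1.1.1, q.1.2)) ?_
      fun_prop)
  refine Eq.trans ?_ h3.symm
  rw [jointRef, lintegral_prod _ hF.aemeasurable]
  change ∫⁻ y, ∫⁻ o, F (y, o) ∂(obsRef ν n) = ∫⁻ h, (∫⁻ y : Fin n → ℂ, _) ∂_
  refine Eq.trans ?_ (lintegral_swap_of_measurable (f := fun h (y : Fin n → ℂ) =>
    ∫⁻ g, (∫⁻ z : Fin n → ℂ, F (y, z, h, g)) ∂(Measure.pi fun _ : Fin n => ν)) ?_).symm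
  · refine lintegral_congr fun y => ?_
    rw [obsRef, lintegral_prod _ (by fun_prop), chanLaw]
    have h4 : ∀ z : Fin n → ℂ, ∫⁻ c, F (y, z, c)
        ∂((Measure.pi fun _ : Fin n => ν).prod (Measure.pi fun _ : Fin n => ν)) =
        ∫⁻ h, ∫⁻ g, F (y, z, h, g) ∂(Measure.pi fun _ : Fin n => ν)
          ∂(Measure.pi fun _ : Fin n => ν) := fun z => lintegral_prod _ (by fun_prop)
    rw [lintegral_congr h4, lintegral_swap_of_measurable]
    · refine lintegral_congr fun h => ?_
      rw [lintegral_swap_of_measurable]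
      fun_prop
    · refine Measurable.lintegral_prod_right' (f := fun q : ((Fin n → ℂ) × (Fin n → Vec M)) ×
        (Fin n → Vec M) => F (y, q.1.1, q.1.2, q.2)) ?_
      fun_prop
  · refine Measurable.lintegral_prod_right' (f := fun q : ((Fin n → Vec M) × (Fin n → ℂ)) ×
        (Fin n → Vec M) => ∫⁻ z : Fin n → ℂ, F (q.1.2, z, q.1.1, q.2)) ?_
    refine Measurable.lintegral_prod_right' (f := fun q : (((Fin n → Vec M) × (Fin n → ℂ)) ×
        (Fin n → Vec M)) × (Fin n → ℂ) => F (q.1.1.2, q.2, q.1.1.1, q.1.2)) ?_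
    fun_prop

end Ref

namespace Code

variable {M n : ℕ} (C : Code M n)

/-- The channel input at time `t`, given message, private randomness and channel vectors. -/
def inp (t : Fin n) (p : (Fin C.numMsg × C.Rand) × Chan M n) : Vec M :=
  C.enc t (p.1.1, p.1.2, fun s => p.2.1 (Fin.castLE t.isLt.le s),
    fun s => p.2.2 (Fin.castLE t.isLt.le s))

@[fun_prop]
lemma measurable_inp (t : Fin n) : Measurable (C.inp t) :=
  (C.measurable_enc t).comp (by fun_prop)

/-- The noiseless output at time `t` of the channel with vectors `sel c`. -/
def mean (sel : Chan M n → Fin n → Vec M) (t : Fin n) (p : (Fin C.numMsg × C.Rand) × Chan M n) : ℂ :=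
  dot (sel p.2 t) (C.inp t p)

lemma measurable_mean {sel : Chan M n → Fin n → Vec M} (hsel : Measurable sel) (t : Fin n) :
    Measurable (C.mean sel t) := by
  unfold mean
  have : Measurable fun p : (Fin C.numMsg × C.Rand) × Chan M n => (sel p.2 t, C.inp t p) := by
    fun_prop
  exact measurable_dot.comp this

/-- The likelihood of the output of the channel with vectors `sel c`. -/
def lik (sel : Chan M n → Fin n → Vec M) (p : (Fin C.numMsg × C.Rand) × Obs M n) : ℝ≥0∞ :=
  ∏ t, cgDens 1 (p.2.1 t - C.mean sel t (p.1, p.2.2))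

lemma measurable_lik {sel : Chan M n → Fin n → Vec M} (hsel : Measurable sel) :
    Measurable (C.lik sel) := by
  refine Finset.measurable_prod _ fun t _ => ?_
  have h := (C.measurable_mean hsel t).comp
    (by fun_prop : Measurable fun p : (Fin C.numMsg × C.Rand) × Obs M n => (p.1, p.2.2))
  have h2 : Measurable fun p : (Fin C.numMsg × C.Rand) × Obs M n =>
      ((1 : ℝ), p.2.1 t - C.mean sel t (p.1, p.2.2)) :=
    measurable_const.prodMk ((by fun_prop : Measurable _).sub h)
  exact measurable_cgDens.comp h2

lemma lik_pos (sel : Chan M n → Fin n → Vec M) (p) : 0 < C.lik sel p :=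
  pos_iff_ne_zero.2 (Finset.prod_ne_zero_iff.2 fun _ _ => (cgDens_pos one_pos _).ne')

lemma lik_le_one (sel : Chan M n → Fin n → Vec M) (p) : C.lik sel p ≤ 1 :=
  Finset.prod_le_one' fun _ _ => cgDens_le_one le_rfl _

lemma lintegral_lik (sel : Chan M n → Fin n → Vec M) (θ : Fin C.numMsg × C.Rand) (c : Chan M n) :
    ∫⁻ v : Fin n → ℂ, C.lik sel (θ, v, c) = 1 := by
  have := lintegral_add_noise (n := n) (fun t => C.mean sel t (θ, c)) (G := fun _ => 1)
    measurable_const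
  simpa [lik] using this.symm

/-- The density of one output, jointly with the channel vectors, given the message. -/
def dens (sel : Chan M n → Fin n → Vec M) (p : Fin C.numMsg × Obs M n) : ℝ≥0∞ :=
  ∫⁻ s, C.lik sel ((p.1, s), p.2) ∂C.randLaw

/-- The likelihood of both outputs. -/
def jointLik (p : (Fin C.numMsg × C.Rand) × (Fin n → ℂ) × Obs M n) : ℝ≥0∞ :=
  C.lik Prod.fst (p.1, p.2.1, p.2.2.2) * C.lik Prod.snd (p.1, p.2.2)

/-- The density of both outputs, jointly with the channel vectors, given the message. -/
def jointDens (p : Fin C.numMsg × (Fin n → ℂ) × Obs M n) : ℝ≥0∞ :=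
  ∫⁻ s, C.jointLik ((p.1, s), p.2) ∂C.randLaw

lemma measurable_dens {sel : Chan M n → Fin n → Vec M} (hsel : Measurable sel) :
    Measurable (C.dens sel) := by
  refine Measurable.lintegral_prod_right' (f := fun q : (Fin C.numMsg × Obs M n) × C.Rand =>
    C.lik sel ((q.1.1, q.2), q.1.2)) ?_
  exact (C.measurable_lik hsel).comp (by fun_prop)

@[fun_prop]
lemma measurable_jointLik : Measurable C.jointLik := by
  have h1 := C.measurable_lik measurable_fst
  have h2 := C.measurable_lik measurable_snd
  unfold jointLik
  fun_prop

lemma jointLik_pos (p) : 0 < C.jointLik p :=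
  ENNReal.mul_pos (C.lik_pos _ _).ne' (C.lik_pos _ _).ne'

@[fun_prop]
lemma measurable_jointDens : Measurable C.jointDens := by
  refine Measurable.lintegral_prod_right' (f := fun q : (Fin C.numMsg × (Fin n → ℂ) × Obs M n) ×
    C.Rand => C.jointLik ((q.1.1, q.2), q.1.2)) ?_
  fun_prop

lemma dens_pos {sel : Chan M n → Fin n → Vec M} (hsel : Measurable sel) (p) : 0 < C.dens sel p :=
  lintegral_pos_of_pos ((C.measurable_lik hsel).comp (by fun_prop)) fun _ => C.lik_pos _ _

lemma dens_le_one (sel : Chan M n → Fin n → Vec M) (p) : C.dens sel p ≤ 1 :=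
  lintegral_le_one_of_le_one fun _ => C.lik_le_one _ _

lemma jointDens_pos (p) : 0 < C.jointDens p := by
  have hm : Measurable fun s => C.jointLik ((p.1, s), p.2) := by fun_prop
  exact lintegral_pos_of_pos hm fun _ => C.jointLik_pos _

/-- The likelihood of `y` is at most 1 and can be dropped. This is a pointwise form of h(y^n | z^n,
W) ≥ 0. -/
lemma jointDens_le_dens_snd (p : Fin C.numMsg × (Fin n → ℂ) × Obs M n) :
    C.jointDens p ≤ C.dens Prod.snd (p.1, p.2.2) :=
  lintegral_mono fun _ => mul_le_of_le_one_left' (C.lik_le_one _ _)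

lemma jointDens_le_one (p) : C.jointDens p ≤ 1 :=
  (C.jointDens_le_dens_snd p).trans (C.dens_le_one _ _)

lemma lintegral_jointDens_snd (w : Fin C.numMsg) (y : Fin n → ℂ) (c : Chan M n) :
    ∫⁻ z : Fin n → ℂ, C.jointDens (w, y, z, c) = C.dens Prod.fst (w, y, c) := by
  unfold jointDens dens
  have hm : Measurable fun p : (Fin n → ℂ) × C.Rand => C.jointLik ((w, p.2), y, p.1, c) := by fun_prop
  rw [lintegral_swap_of_measurable hm]
  refine lintegral_congr fun s => ?_
  have h : Measurable fun z : Fin n → ℂ => C.lik Prod.snd ((w, s), z, c) :=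
    (C.measurable_lik measurable_snd).comp (by fun_prop)
  simp only [jointLik]
  rw [lintegral_const_mul _ h, lintegral_lik, mul_one]

lemma lintegral_jointDens_fst (w : Fin C.numMsg) (z : Fin n → ℂ) (c : Chan M n) :
    ∫⁻ y : Fin n → ℂ, C.jointDens (w, y, z, c) = C.dens Prod.snd (w, z, c) := by
  unfold jointDens dens
  have hm : Measurable fun p : (Fin n → ℂ) × C.Rand => C.jointLik ((w, p.2), p.1, z, c) := by fun_prop
  rw [lintegral_swap_of_measurable hm]
  refine lintegral_congr fun s => ?_
  have h : Measurable fun y : Fin n → ℂ => C.lik Prod.fst ((w, s), y, c) :=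
    (C.measurable_lik measurable_fst).comp (by fun_prop)
  simp only [jointLik]
  rw [lintegral_mul_const _ h, lintegral_lik, one_mul]

variable {ν : Measure (Vec M)} [IsProbabilityMeasure ν]

lemma lintegral_dens {sel : Chan M n → Fin n → Vec M} (hsel : Measurable sel) (w : Fin C.numMsg) :
    ∫⁻ o, C.dens sel (w, o) ∂(obsRef ν n) = 1 := by
  have m := C.measurable_dens hsel
  rw [obsRef, lintegral_prod_symm' _ (by fun_prop)]
  have h : ∀ c : Chan M n, ∫⁻ v : Fin n → ℂ, C.dens sel (w, v, c) = 1 := by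
    intro c
    unfold dens
    have h1 := C.measurable_lik hsel
    have hm : Measurable fun p : (Fin n → ℂ) × C.Rand => C.lik sel ((w, p.2), p.1, c) := by
      fun_prop
    rw [lintegral_swap_of_measurable hm]
    simp [lintegral_lik]
  simp [h]

/-- Marginalization of the output `z`. -/
lemma lintegral_jointDens_mul_fst (w : Fin C.numMsg) {F : Obs M n → ℝ≥0∞} (hF : Measurable F) :
    ∫⁻ o, C.jointDens (w, o) * F (o.1, o.2.2) ∂(jointRef ν n) =
      ∫⁻ o, C.dens Prod.fst (w, o) * F o ∂(obsRef ν n) := by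
  have m := C.measurable_jointDens
  have m1 := C.measurable_dens measurable_fst
  rw [jointRef, lintegral_prod _ (by fun_prop), obsRef, lintegral_prod _ (by fun_prop)]
  refine lintegral_congr fun y => ?_
  rw [lintegral_prod_symm' _ (by fun_prop)]
  refine lintegral_congr fun c => ?_
  have h : Measurable fun z : Fin n → ℂ => C.jointDens (w, y, z, c) := by fun_prop
  rw [← lintegral_jointDens_snd]
  exact lintegral_mul_const (F (y, c)) h

/-- Marginalization of the output `y`. -/
lemma lintegral_jointDens_mul_snd (w : Fin C.numMsg) {F : Obs M n → ℝ≥0∞} (hF : Measurable F) :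
    ∫⁻ o, C.jointDens (w, o) * F o.2 ∂(jointRef ν n) =
      ∫⁻ o, C.dens Prod.snd (w, o) * F o ∂(obsRef ν n) := by
  have m := C.measurable_jointDens
  rw [jointRef, lintegral_prod_symm' _ (by fun_prop)]
  refine lintegral_congr fun o => ?_
  have h : Measurable fun y : Fin n → ℂ => C.jointDens (w, y, o) := by fun_prop
  rw [← lintegral_jointDens_fst]
  exact lintegral_mul_const (F o) h

lemma lintegral_jointDens (w : Fin C.numMsg) :
    ∫⁻ o, C.jointDens (w, o) ∂(jointRef ν n) = 1 := by
  simpa [C.lintegral_dens measurable_fst] using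
    C.lintegral_jointDens_mul_fst (ν := ν) w (F := fun _ => 1) measurable_const

end Code

/-! ### The doubling inequality for a code -/

namespace Code

variable {M n : ℕ} (C : Code M n)

section Doubling

/-- The density of an output when the channel input is `x`, jointly with the channel vector. -/
def slotDens (p : Vec M × Vec M × ℂ) : ℝ≥0∞ := cgDens 1 (p.2.2 - dot p.2.1 p.1)

/-- The channel input as a function of the data of the past time slots. -/
def slotInput (k : ℕ)
    (p : (Fin C.numMsg × C.Rand) × (Fin k → (Vec M × ℂ) × (Vec M × ℂ))) : Vec M :=
  if h : k < n then
    C.enc ⟨k, h⟩ (p.1.1, p.1.2, fun i => (p.2 i).1.1, fun i => (p.2 i).2.1)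
  -- Times from `n` on do not enter the likelihood of `n` slots; the value there is immaterial.
  else 0

@[fun_prop]
lemma measurable_slotDens : Measurable (slotDens (M := M)) := by
  have h : Measurable fun p : Vec M × Vec M × ℂ => dot p.2.1 p.1 :=
    measurable_dot.comp (by fun_prop : Measurable fun p : Vec M × Vec M × ℂ => (p.2.1, p.1))
  have h2 : Measurable fun p : Vec M × Vec M × ℂ => ((1 : ℝ), p.2.2 - dot p.2.1 p.1) := by
    fun_prop
  exact measurable_cgDens.comp h2

lemma lintegral_slotDens {ν : Measure (Vec M)} [IsProbabilityMeasure ν] (x : Vec M) :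
    ∫⁻ a, slotDens (x, a) ∂(ν.prod volume) = 1 := by
  rw [lintegral_prod _ (by fun_prop)]
  have h : ∀ v : Vec M, ∫⁻ y : ℂ, slotDens (x, v, y) = 1 := fun v => by
    simp only [slotDens]
    rw [lintegral_sub_right_eq_self (fun y => cgDens 1 y), lintegral_cgDens one_pos]
  simp [h]

lemma measurable_slotInput (k : ℕ) : Measurable (C.slotInput k) := by
  unfold slotInput
  by_cases h : k < n
  · simp only [h, dite_true]
    exact (C.measurable_enc ⟨k, h⟩).comp (by fun_prop)
  · simp only [h, dite_false]
    exact measurable_const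

lemma mixLik_eq_outDens {ψ : Vec M × (Vec M × ℂ) × (Vec M × ℂ) → ℝ≥0∞} {O : Type*}
    [MeasurableSpace O] {L : (Fin C.numMsg × C.Rand) × O → ℝ≥0∞} (hL : Measurable L)
    (μ : Measure (Fin C.numMsg)) [IsProbabilityMeasure μ] (d : Fin n → (Vec M × ℂ) × (Vec M × ℂ))
    (o : O) (h : ∀ θ, seqLik ψ C.slotInput n (θ, d) = L (θ, o)) :
    mixLik ψ C.slotInput (μ.prod C.randLaw) n d =
      outDens μ (fun p : Fin C.numMsg × O => ∫⁻ s, L ((p.1, s), p.2) ∂C.randLaw) o := by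
  rw [mixLik, lintegral_congr h, lintegral_prod _ (by fun_prop)]
  rfl

variable {ν : Measure (Vec M)} [IsProbabilityMeasure ν]

lemma mixLik_joint (μ : Measure (Fin C.numMsg)) [IsProbabilityMeasure μ]
    (d : Fin n → (Vec M × ℂ) × (Vec M × ℂ)) :
    mixLik (fun p => slotDens (p.1, p.2.1) * slotDens (p.1, p.2.2)) C.slotInput
      (μ.prod C.randLaw) n d = outDens μ C.jointDens
      (fun t => (d t).1.2, fun t => (d t).2.2, fun t => (d t).1.1, fun t => (d t).2.1) := by
  refine C.mixLik_eq_outDens C.measurable_jointLik μ d _ fun θ => ?_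
  rw [seqLik_eq_prod, Finset.prod_mul_distrib]
  simp only [slotInput, Fin.is_lt, dite_true]
  rfl

/-- The inputs read only channel vectors from the past slots, never outputs. The causally
conditioned density of the half belonging to `y` is therefore the genuine density of `y` with all
channel vectors. -/
lemma mixLik_fst (μ : Measure (Fin C.numMsg)) [IsProbabilityMeasure μ]
    (d : Fin n → (Vec M × ℂ) × (Vec M × ℂ)) :
    mixLik (fun p => slotDens (p.1, p.2.1)) C.slotInput
      (μ.prod C.randLaw) n d = outDens μ (C.dens Prod.fst)
      (fun t => (d t).1.2, fun t => (d t).1.1, fun t => (d t).2.1) := by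
  refine C.mixLik_eq_outDens (C.measurable_lik measurable_fst) μ d _ fun θ => ?_
  rw [seqLik_eq_prod]
  simp only [slotInput, Fin.is_lt, dite_true]
  rfl

lemma mixLik_snd (μ : Measure (Fin C.numMsg)) [IsProbabilityMeasure μ]
    (d : Fin n → (Vec M × ℂ) × (Vec M × ℂ)) :
    mixLik (fun p => slotDens (p.1, p.2.2)) C.slotInput
      (μ.prod C.randLaw) n d = outDens μ (C.dens Prod.snd)
      (fun t => (d t).2.2, fun t => (d t).1.1, fun t => (d t).2.1) := by
  refine C.mixLik_eq_outDens (C.measurable_lik measurable_snd) μ d _ fun θ => ?_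
  rw [seqLik_eq_prod]
  simp only [slotInput, Fin.is_lt, dite_true]
  rfl

lemma slotDens_pos (p : Vec M × Vec M × ℂ) : 0 < slotDens p := cgDens_pos one_pos _

lemma slotDens_le_one (p : Vec M × Vec M × ℂ) : slotDens p ≤ 1 := cgDens_le_one le_rfl _

/-- The message law is left free: a Dirac measure gives entropies conditioned on the message, the
uniform law unconditional ones. -/
lemma lintegral_negLog_jointDens_le_fst (μ : Measure (Fin C.numMsg)) [IsProbabilityMeasure μ] :
    ∫⁻ o, outDens μ C.jointDens o * negLog (outDens μ C.jointDens o) ∂(jointRef ν n) ≤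
      2 * ∫⁻ o, outDens μ C.jointDens o * negLog (outDens μ (C.dens Prod.fst) (o.1, o.2.2))
        ∂(jointRef ν n) := by
  have m := C.measurable_dens measurable_fst
  rw [lintegral_jointRef (by fun_prop), lintegral_jointRef (by fun_prop)]
  simp_rw [← C.mixLik_joint, ← C.mixLik_fst]
  exact lintegral_negLog_mixLik_le measurable_slotDens slotDens_pos slotDens_le_one
    lintegral_slotDens C.measurable_slotInput (Or.inl rfl) n

lemma lintegral_negLog_jointDens_le_snd (μ : Measure (Fin C.numMsg)) [IsProbabilityMeasure μ] :
    ∫⁻ o, outDens μ C.jointDens o * negLog (outDens μ C.jointDens o) ∂(jointRef ν n) ≤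
      2 * ∫⁻ o, outDens μ C.jointDens o * negLog (outDens μ (C.dens Prod.snd) o.2)
        ∂(jointRef ν n) := by
  have m := C.measurable_dens measurable_snd
  rw [lintegral_jointRef (by fun_prop), lintegral_jointRef (by fun_prop)]
  simp_rw [← C.mixLik_joint, ← C.mixLik_snd]
  exact lintegral_negLog_mixLik_le measurable_slotDens slotDens_pos slotDens_le_one
    lintegral_slotDens C.measurable_slotInput (Or.inr rfl) n

variable (ν)

instance : NeZero C.numMsg := ⟨C.numMsg_pos.ne'⟩

/-- The law of the message. -/
abbrev msgLaw : Measure (Fin C.numMsg) := ProbabilityTheory.uniformOn Set.univ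

/-- Doubling with the message fixed, then averaged over the message. The legitimate half is kept
here, as Fano's inequality bounds h(y^n | W). -/
lemma condEnt_jointDens_le :
    condEnt C.msgLaw (jointRef ν n) C.jointDens ≤
      2 * condEnt C.msgLaw (obsRef ν n) (C.dens Prod.fst) := by
  have m := C.measurable_dens measurable_fst
  unfold condEnt
  rw [lintegral_prod _ (by fun_prop), lintegral_prod _ (by fun_prop), ← lintegral_const_mul _
    (Measurable.lintegral_prod_right' (by fun_prop :
      Measurable fun p : Fin C.numMsg × Obs M n =>
        C.dens Prod.fst p * negLog (C.dens Prod.fst p)))]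
  refine lintegral_mono fun w => ?_
  have h := C.lintegral_negLog_jointDens_le_fst (ν := ν) (Measure.dirac w)
  simp only [outDens, lintegral_dirac] at h
  rwa [C.lintegral_jointDens_mul_fst w (F := fun o => negLog (C.dens Prod.fst (w, o)))
    (by fun_prop)] at h

/-- Doubling with a random message. The eavesdropper's half is kept here, as the leakage controls
h(z^n). -/
lemma outEnt_jointDens_le :
    outEnt C.msgLaw (jointRef ν n) C.jointDens ≤
      2 * outEnt C.msgLaw (obsRef ν n) (C.dens Prod.snd) := by
  have m := C.measurable_dens measurable_snd
  have m2 := measurable_outDens (τ := C.msgLaw) m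
  have mj := C.measurable_jointDens
  rw [outEnt_eq mj]
  refine (C.lintegral_negLog_jointDens_le_snd C.msgLaw).trans_eq ?_
  congr 1
  rw [← lintegral_mul_comp_snd (τ := C.msgLaw) mj
    (F := fun o => negLog (outDens C.msgLaw (C.dens Prod.snd) o.2)) (by fun_prop), outEnt,
    lintegral_prod _ (by fun_prop), lintegral_prod _ (by fun_prop)]
  exact lintegral_congr fun w => C.lintegral_jointDens_mul_snd w
    (F := fun o => negLog (outDens C.msgLaw (C.dens Prod.snd) o)) (by fun_prop)

end Doubling

/-! ### Joint laws of the message and the observations -/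

section Law

variable (ν : Measure (Vec M)) [IsProbabilityMeasure ν]

instance : IsProbabilityMeasure (C.law ν) := by unfold law; infer_instance

@[fun_prop]
lemma measurable_outY : Measurable C.outY := by
  refine measurable_pi_lambda _ fun t => ?_
  have h := (C.measurable_mean measurable_fst t).comp
    (by fun_prop : Measurable fun ω : C.Sample => ((ω.1, ω.2.1), (ω.2.2.1, ω.2.2.2.1)))
  exact h.add (by fun_prop : Measurable fun ω : C.Sample => ω.2.2.2.2.1 t)

@[fun_prop]
lemma measurable_outZ : Measurable C.outZ := by
  refine measurable_pi_lambda _ fun t => ?_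
  have h := (C.measurable_mean measurable_snd t).comp
    (by fun_prop : Measurable fun ω : C.Sample => ((ω.1, ω.2.1), (ω.2.2.1, ω.2.2.2.1)))
  exact h.add (by fun_prop : Measurable fun ω : C.Sample => ω.2.2.2.2.2 t)

@[fun_prop]
lemma measurable_chanH : Measurable C.chanH := by unfold chanH; fun_prop

@[fun_prop]
lemma measurable_chanG : Measurable C.chanG := by unfold chanG; fun_prop

@[fun_prop]
lemma measurable_msg : Measurable C.msg := by unfold msg; fun_prop

lemma lintegral_jointRef_chan {K : (Fin n → ℂ) × Obs M n → ℝ≥0∞} (hK : Measurable K) :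
    ∫⁻ o, K o ∂(jointRef ν n) =
      ∫⁻ h, ∫⁻ g, (∫⁻ y : Fin n → ℂ, ∫⁻ z : Fin n → ℂ, K (y, z, h, g))
        ∂(Measure.pi fun _ : Fin n => ν) ∂(Measure.pi fun _ : Fin n => ν) := by
  have h1 : Measurable fun q : (Chan M n × (Fin n → ℂ)) × (Fin n → ℂ) => K (q.1.2, q.2, q.1.1) := by
    fun_prop
  have h2 : Measurable fun q : Chan M n × (Fin n → ℂ) => ∫⁻ z : Fin n → ℂ, K (q.2, z, q.1) :=
    h1.lintegral_prod_right'
  have h3 : Measurable fun c : Chan M n => ∫⁻ y : Fin n → ℂ, ∫⁻ z : Fin n → ℂ, K (y, z, c) :=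
    h2.lintegral_prod_right'
  rw [← lintegral_prod (fun c : Chan M n => ∫⁻ y : Fin n → ℂ, ∫⁻ z : Fin n → ℂ, K (y, z, c))
    h3.aemeasurable, ← chanLaw, lintegral_swap_of_measurable h2, jointRef,
    lintegral_prod _ hK.aemeasurable]
  refine lintegral_congr fun y => ?_
  have hy : Measurable fun o => K (y, o) := by fun_prop
  rw [obsRef, lintegral_prod_symm' _ hy]

/-- The joint law of the message, both outputs and the channel vectors. -/
lemma lintegral_law_joint {F : Fin C.numMsg × (Fin n → ℂ) × Obs M n → ℝ≥0∞} (hF : Measurable F) :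
    ∫⁻ ω, F (C.msg ω, C.outY ω, C.outZ ω, C.chanH ω, C.chanG ω) ∂(C.law ν) =
      ∫⁻ p, C.jointDens p * F p ∂(C.msgLaw.prod (jointRef ν n)) := by
  have mG : Measurable fun ω : C.Sample =>
    F (C.msg ω, C.outY ω, C.outZ ω, C.chanH ω, C.chanG ω) := by fun_prop
  rw [lintegral_prod _ (by fun_prop), law, lintegral_prod _ mG.aemeasurable]
  refine lintegral_congr fun w => ?_
  rw [lintegral_prod _ (by fun_prop)]
  have hRHS : ∫⁻ o, C.jointDens (w, o) * F (w, o) ∂(jointRef ν n) =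
      ∫⁻ s, ∫⁻ o, C.jointLik ((w, s), o) * F (w, o) ∂(jointRef ν n) ∂C.randLaw := by
    have hm : Measurable fun p : C.Rand × ((Fin n → ℂ) × Obs M n) =>
      C.jointLik ((w, p.1), p.2) * F (w, p.2) := by fun_prop
    rw [lintegral_swap_of_measurable hm]
    refine lintegral_congr fun o => ?_
    have hm2 : Measurable fun s : C.Rand => C.jointLik ((w, s), o) := by fun_prop
    exact (lintegral_mul_const (F (w, o)) hm2).symm
  rw [hRHS]
  refine lintegral_congr fun s => ?_
  rw [lintegral_jointRef_chan ν (by fun_prop), lintegral_prod _ (by fun_prop)]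
  refine lintegral_congr fun h => ?_
  rw [lintegral_prod _ (by fun_prop)]
  refine lintegral_congr fun g => ?_
  rw [lintegral_prod _ (by fun_prop)]
  have m1 := C.measurable_lik measurable_fst
  have m2 := C.measurable_lik measurable_snd
  have mH : Measurable fun y : Fin n → ℂ =>
      ∫⁻ z : Fin n → ℂ, C.lik Prod.snd ((w, s), z, (h, g)) * F (w, y, z, (h, g)) := by
    refine Measurable.lintegral_prod_right' (f := fun q : (Fin n → ℂ) × (Fin n → ℂ) =>
      C.lik Prod.snd ((w, s), q.2, (h, g)) * F (w, q.1, q.2, (h, g))) ?_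
    fun_prop
  -- With message, randomness and channels fixed, the means of both outputs are constants. The noise
  -- `b` and then the noise `e` are translated by them.
  calc _ = ∫⁻ e, (∫⁻ z : Fin n → ℂ, C.lik Prod.snd ((w, s), z, (h, g)) *
          F (w, (fun t => C.mean Prod.fst t ((w, s), (h, g)) + e t), z, (h, g)))
          ∂(Measure.pi fun _ : Fin n => stdComplexGaussian) :=
        lintegral_congr fun e => lintegral_add_noise
          (fun t => C.mean Prod.snd t ((w, s), (h, g)))
          (G := fun z => F (w, (fun t => C.mean Prod.fst t ((w, s), (h, g)) + e t), z, (h, g)))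
          (by fun_prop)
    _ = ∫⁻ y : Fin n → ℂ, C.lik Prod.fst ((w, s), y, (h, g)) *
          ∫⁻ z : Fin n → ℂ, C.lik Prod.snd ((w, s), z, (h, g)) * F (w, y, z, (h, g)) :=
        lintegral_add_noise _ mH
    _ = _ := by
        refine lintegral_congr fun y => ?_
        rw [← lintegral_const_mul _ (by fun_prop)]
        refine lintegral_congr fun z => ?_
        rw [jointLik, mul_assoc]

lemma lintegral_law_fst {F : Fin C.numMsg × Obs M n → ℝ≥0∞} (hF : Measurable F) :
    ∫⁻ ω, F (C.msg ω, C.outY ω, C.chanH ω, C.chanG ω) ∂(C.law ν) =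
      ∫⁻ p, C.dens Prod.fst p * F p ∂(C.msgLaw.prod (obsRef ν n)) := by
  have m := C.measurable_dens measurable_fst
  rw [C.lintegral_law_joint ν (F := fun p => F (p.1, p.2.1, p.2.2.2)) (by fun_prop),
    lintegral_prod _ (by fun_prop), lintegral_prod _ (by fun_prop)]
  exact lintegral_congr fun w => C.lintegral_jointDens_mul_fst w (F := fun o => F (w, o))
    (by fun_prop)

lemma lintegral_law_snd {F : Fin C.numMsg × Obs M n → ℝ≥0∞} (hF : Measurable F) :
    ∫⁻ ω, F (C.msg ω, C.outZ ω, C.chanH ω, C.chanG ω) ∂(C.law ν) =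
      ∫⁻ p, C.dens Prod.snd p * F p ∂(C.msgLaw.prod (obsRef ν n)) := by
  have m := C.measurable_dens measurable_snd
  rw [C.lintegral_law_joint ν (F := fun p => F (p.1, p.2.2)) (by fun_prop),
    lintegral_prod _ (by fun_prop), lintegral_prod _ (by fun_prop)]
  exact lintegral_congr fun w => C.lintegral_jointDens_mul_snd w (F := fun o => F (w, o))
    (by fun_prop)

/-- Differential entropy need not grow when a variable is added. It does here, since the noise
density is at most 1. -/
lemma condEnt_dens_snd_le :
    condEnt C.msgLaw (obsRef ν n) (C.dens Prod.snd) ≤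
      condEnt C.msgLaw (jointRef ν n) C.jointDens := by
  have m := C.measurable_dens measurable_snd
  rw [condEnt, condEnt, ← C.lintegral_law_snd ν (F := fun p => negLog (C.dens Prod.snd p))
    (by fun_prop), ← C.lintegral_law_joint ν (F := fun p => negLog (C.jointDens p)) (by fun_prop)]
  exact lintegral_mono fun ω =>
    negLog_anti (C.jointDens_pos _) (C.jointDens_le_dens_snd _) (C.dens_le_one _ _)

lemma leakage_eq : C.leakage ν = InformationTheory.klDiv
    ((C.msgLaw.prod (obsRef ν n)).withDensity (C.dens Prod.snd))
    (C.msgLaw.prod ((obsRef ν n).withDensity (outDens C.msgLaw (C.dens Prod.snd)))) /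
      ENNReal.ofReal (Real.log 2) := by
  have m := C.measurable_dens measurable_snd
  have h1 : (C.law ν).map C.msg = C.msgLaw := by
    unfold law msg; exact measurePreserving_fst.map_eq
  have h2 : (C.law ν).map (fun ω => (C.msg ω, C.outZ ω, C.chanH ω, C.chanG ω)) =
      (C.msgLaw.prod (obsRef ν n)).withDensity (C.dens Prod.snd) := by
    refine Measure.ext_of_lintegral _ fun F hF => ?_
    rw [lintegral_map hF (by fun_prop), C.lintegral_law_snd ν hF,
      lintegral_withDensity_eq_lintegral_mul _ m hF]
    rfl
  have h3 : (C.law ν).map (fun ω => (C.outZ ω, C.chanH ω, C.chanG ω)) =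
      (obsRef ν n).withDensity (outDens C.msgLaw (C.dens Prod.snd)) := by
    refine Measure.ext_of_lintegral _ fun F hF => ?_
    rw [lintegral_map hF (by fun_prop), C.lintegral_law_snd ν (F := fun p => F p.2) (by fun_prop),
      lintegral_withDensity_eq_lintegral_mul _ (measurable_outDens m) hF,
      lintegral_mul_comp_snd m hF]
    rfl
  rw [leakage, mutualInfo, h1, h2, h3]

lemma errorProb_eq_fst : C.errorProb ν = ∫⁻ p, C.dens Prod.fst p *
    Set.indicator {p | C.dec p.2 ≠ p.1} 1 p ∂(C.msgLaw.prod (obsRef ν n)) := by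
  have hdec := C.measurable_dec
  have mS : MeasurableSet {p : Fin C.numMsg × Obs M n | C.dec p.2 ≠ p.1} :=
    (measurableSet_eq_fun (hdec.comp measurable_snd) measurable_fst).compl
  rw [← C.lintegral_law_fst ν (measurable_one.indicator mS), errorProb]
  have mE : MeasurableSet {ω | C.dec (C.outY ω, C.chanH ω, C.chanG ω) ≠ C.msg ω} :=
    mS.preimage (by fun_prop : Measurable fun ω => (C.msg ω, C.outY ω, C.chanH ω, C.chanG ω))
  rw [← lintegral_indicator_one mE]
  rfl

/-- Lets Fano's inequality be applied to both outputs with the decoder that ignores `z`, at the same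
error probability. -/
lemma errorProb_eq_joint : C.errorProb ν = ∫⁻ p, C.jointDens p *
    Set.indicator {p | C.dec (p.2.1, p.2.2.2) ≠ p.1} 1 p ∂(C.msgLaw.prod (jointRef ν n)) := by
  have hdec := C.measurable_dec
  have mS : MeasurableSet {p : Fin C.numMsg × (Fin n → ℂ) × Obs M n |
      C.dec (p.2.1, p.2.2.2) ≠ p.1} :=
    (measurableSet_eq_fun (hdec.comp (by fun_prop)) measurable_fst).compl
  rw [← C.lintegral_law_joint ν (measurable_one.indicator mS), errorProb]
  have mE : MeasurableSet {ω | C.dec (C.outY ω, C.chanH ω, C.chanG ω) ≠ C.msg ω} :=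
    mS.preimage (by fun_prop :
      Measurable fun ω => (C.msg ω, C.outY ω, C.outZ ω, C.chanH ω, C.chanG ω))
  rw [← lintegral_indicator_one mE]
  rfl

end Law

end Code

/-! ### Entropy bounds from the power constraint -/

lemma sqNorm_nonneg {M : ℕ} (x : Vec M) : 0 ≤ sqNorm x := by
  unfold sqNorm; positivity

@[fun_prop]
lemma measurable_sqNorm {M : ℕ} : Measurable (sqNorm (M := M)) := by
  unfold sqNorm; fun_prop

lemma sq_norm_dot_le {M : ℕ} (a b : Vec M) : ‖dot a b‖ ^ 2 ≤ sqNorm a * sqNorm b := by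
  have h1 : ‖dot a b‖ ≤ ∑ i, ‖a i‖ * ‖b i‖ := by
    refine (norm_sum_le _ _).trans_eq ?_
    simp
  calc ‖dot a b‖ ^ 2 ≤ (∑ i, ‖a i‖ * ‖b i‖) ^ 2 := by gcongr
    _ ≤ _ := Finset.sum_mul_sq_le_sq_mul_sq _ _ _

/-- By Cauchy–Schwarz, the factor `sqNorm v` of the signal power cancels against the variance `1 + P
* sqNorm v`. Thus no second moment of the channel is needed. -/
lemma sq_norm_output_div_le {M : ℕ} (v x : Vec M) (e : ℂ) {P : ℝ} (hP : 0 < P) :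
    ‖dot v x + e‖ ^ 2 / (1 + P * sqNorm v) ≤ 2 / P * sqNorm x + 2 * ‖e‖ ^ 2 := by
  have hv := sqNorm_nonneg v
  have hx := sqNorm_nonneg x
  have h0 := sq_norm_dot_le v x
  have h1 : ‖dot v x + e‖ ^ 2 ≤ 2 * ‖dot v x‖ ^ 2 + 2 * ‖e‖ ^ 2 := by
    have := norm_add_le (dot v x) e
    have h2 : ‖dot v x + e‖ ^ 2 ≤ (‖dot v x‖ + ‖e‖) ^ 2 := by gcongr
    nlinarith [sq_nonneg (‖dot v x‖ - ‖e‖)]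
  have hs : 0 < 1 + P * sqNorm v := by positivity
  rw [div_le_iff₀ hs]
  have e1 : 2 / P * sqNorm x * (1 + P * sqNorm v) =
      2 / P * sqNorm x + 2 * (sqNorm v * sqNorm x) := by field_simp
  have e2 : 0 ≤ 2 / P * sqNorm x := by positivity
  have e3 : 0 ≤ ‖e‖ ^ 2 * (P * sqNorm v) := by positivity
  rw [add_mul, e1]
  nlinarith

/-- For `P ≥ 1`, `1 + P a ≤ P (1 + a)`. This separates the power from the fading, whose only trace
is the mean of `log (1 + ‖h‖ ^ 2)`. -/
lemma log_one_add_mul_le {P a : ℝ} (hP : 1 ≤ P) (ha : 0 ≤ a) :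
    Real.log (1 + P * a) ≤ Real.log P + Real.log (1 + a) := by
  rw [← Real.log_mul (by positivity) (by positivity)]
  exact Real.log_le_log (by positivity) (by nlinarith)

lemma negLog_cgDens {s : ℝ} (hs : 0 < s) (z : ℂ) :
    negLog (cgDens s z) = ENNReal.ofReal (Real.log Real.pi + Real.log s + ‖z‖ ^ 2 / s) := by
  have hpi := Real.pi_pos
  rw [negLog, cgDens, ENNReal.toReal_ofReal (by positivity),
    Real.log_mul (by positivity) (Real.exp_pos _).ne', Real.log_inv,
    Real.log_mul hpi.ne' hs.ne', Real.log_exp]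
  congr 1
  ring

lemma negLog_cgDens_output_le {M : ℕ} (v x : Vec M) (e : ℂ) {P : ℝ} (hP : 1 ≤ P) :
    negLog (cgDens (1 + P * sqNorm v) (dot v x + e)) ≤
      ENNReal.ofReal (Real.log Real.pi + Real.log P) + ENNReal.ofReal (Real.log (1 + sqNorm v)) +
        ENNReal.ofReal (2 / P) * ENNReal.ofReal (sqNorm x) + 2 * ENNReal.ofReal (‖e‖ ^ 2) := by
  have hv := sqNorm_nonneg v
  have hx := sqNorm_nonneg x
  have l1 : 0 ≤ Real.log Real.pi := Real.log_nonneg (by linarith [Real.pi_gt_three])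
  have l2 : 0 ≤ Real.log P := Real.log_nonneg hP
  have l3 : 0 ≤ Real.log (1 + sqNorm v) := Real.log_nonneg (by linarith)
  rw [negLog_cgDens (by positivity), show (2 : ℝ≥0∞) = ENNReal.ofReal 2 by simp,
    ← ENNReal.ofReal_mul (by positivity), ← ENNReal.ofReal_mul (by positivity),
    ← ENNReal.ofReal_add (by positivity) l3, ← ENNReal.ofReal_add (by positivity) (by positivity),
    ← ENNReal.ofReal_add (by positivity) (by positivity)]
  refine ENNReal.ofReal_le_ofReal ?_
  have h1 := sq_norm_output_div_le v x e (show 0 < P by linarith)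
  have h2 := log_one_add_mul_le hP hv
  linarith

/-- The product of centered Gaussian densities of variances `1 + P ‖sel c t‖ ^ 2`. -/
def fadingDens {M n : ℕ} (P : ℝ) (sel : Chan M n → Fin n → Vec M) (o : Obs M n) : ℝ≥0∞ :=
  ∏ t, cgDens (1 + P * sqNorm (sel o.2 t)) (o.1 t)

section FadingDens

variable {M n : ℕ} {P : ℝ} {sel : Chan M n → Fin n → Vec M}

lemma measurable_fadingDens (hsel : Measurable sel) : Measurable (fadingDens P sel) := by
  refine Finset.measurable_prod _ fun t _ => ?_
  have h : Measurable fun o : Obs M n => (1 + P * sqNorm (sel o.2 t), o.1 t) := by fun_prop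
  exact measurable_cgDens.comp h

lemma one_le_fadingVar (hP : 0 ≤ P) (v : Vec M) : 1 ≤ 1 + P * sqNorm v := by
  have := sqNorm_nonneg v
  have : 0 ≤ P * sqNorm v := by positivity
  linarith

lemma fadingDens_pos (hP : 0 ≤ P) (o : Obs M n) : 0 < fadingDens P sel o :=
  pos_iff_ne_zero.2 (Finset.prod_ne_zero_iff.2 fun _ _ =>
    (cgDens_pos (one_pos.trans_le (one_le_fadingVar hP _)) _).ne')

lemma fadingDens_le_one (hP : 0 ≤ P) (o : Obs M n) : fadingDens P sel o ≤ 1 :=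
  Finset.prod_le_one' fun _ _ => cgDens_le_one (one_le_fadingVar hP _) _

lemma lintegral_fadingDens {ν : Measure (Vec M)} [IsProbabilityMeasure ν] (hP : 0 ≤ P)
    (hsel : Measurable sel) : ∫⁻ o, fadingDens P sel o ∂(obsRef ν n) = 1 := by
  have m := measurable_fadingDens (P := P) hsel
  rw [obsRef, lintegral_prod_symm' _ m]
  have h : ∀ c : Chan M n, ∫⁻ v : Fin n → ℂ, fadingDens P sel (v, c) = 1 := by
    intro c
    refine (lintegral_pi_prod (κ := (volume : Measure ℂ))
      (fun t => cgDens (1 + P * sqNorm (sel c t)))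
      fun t => measurable_cgDens.comp
        (by fun_prop : Measurable fun z : ℂ => (1 + P * sqNorm (sel c t), z))).trans ?_
    exact Finset.prod_eq_one fun t _ =>
      lintegral_cgDens (one_pos.trans_le (one_le_fadingVar hP _))
  simp [h]

end FadingDens

namespace Code

variable {M n : ℕ} (C : Code M n) (ν : Measure (Vec M)) [IsProbabilityMeasure ν]

/-- The mean of `log (1 + ‖h‖ ^ 2)`. -/
def meanLog {M : ℕ} (ν : Measure (Vec M)) : ℝ≥0∞ :=
  ∫⁻ v, ENNReal.ofReal (Real.log (1 + sqNorm v)) ∂ν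

lemma measurePreserving_chanH (t : Fin n) :
    MeasurePreserving (fun ω => C.chanH ω t) (C.law ν) ν := by
  unfold law chanH
  exact (measurePreserving_eval (fun _ : Fin n => ν) t).comp
    (measurePreserving_fst.comp (measurePreserving_snd.comp measurePreserving_snd))

lemma measurePreserving_chanG (t : Fin n) :
    MeasurePreserving (fun ω => C.chanG ω t) (C.law ν) ν := by
  unfold law chanG
  exact (measurePreserving_eval (fun _ : Fin n => ν) t).comp
    (measurePreserving_fst.comp (measurePreserving_snd.comp
      (measurePreserving_snd.comp measurePreserving_snd)))

lemma measurePreserving_noiseE (t : Fin n) :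
    MeasurePreserving (fun ω => C.noiseE ω t) (C.law ν) stdComplexGaussian := by
  unfold law noiseE
  exact (measurePreserving_eval (fun _ : Fin n => stdComplexGaussian) t).comp
    (measurePreserving_fst.comp (measurePreserving_snd.comp (measurePreserving_snd.comp
      (measurePreserving_snd.comp measurePreserving_snd))))

lemma measurePreserving_noiseB (t : Fin n) :
    MeasurePreserving (fun ω => C.noiseB ω t) (C.law ν) stdComplexGaussian := by
  unfold law noiseB
  exact (measurePreserving_eval (fun _ : Fin n => stdComplexGaussian) t).comp
    (measurePreserving_snd.comp (measurePreserving_snd.comp (measurePreserving_snd.comp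
      (measurePreserving_snd.comp measurePreserving_snd))))

lemma measurable_input (t : Fin n) : Measurable fun ω => C.input ω t :=
  (C.measurable_inp t).comp
    (by fun_prop : Measurable fun ω : C.Sample => ((ω.1, ω.2.1), (ω.2.2.1, ω.2.2.2.1)))

variable {C ν}

/-- A power constraint bounds the cross entropy of an output with respect to Gaussian densities. -/
lemma lintegral_negLog_fadingDens_le {P : ℝ} (hP : 1 ≤ P) (hC : C.PowerConstraint ν P)
    {sel : Chan M n → Fin n → Vec M} (noise : C.Sample → Fin n → ℂ)
    (hsel : ∀ t, MeasurePreserving (fun ω => sel (C.chanH ω, C.chanG ω) t) (C.law ν) ν)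
    (hnoise : ∀ t, MeasurePreserving (fun ω => noise ω t) (C.law ν) stdComplexGaussian) :
    ∫⁻ ω, negLog (fadingDens P sel
      (fun t => dot (sel (C.chanH ω, C.chanG ω) t) (C.input ω t) + noise ω t,
        C.chanH ω, C.chanG ω)) ∂(C.law ν) ≤
      n * (ENNReal.ofReal (Real.log Real.pi + Real.log P) + meanLog ν + 10) := by
  have hP0 : 0 < P := by linarith
  have hlog : Measurable fun v : Vec M => ENNReal.ofReal (Real.log (1 + sqNorm v)) := by fun_prop
  have hnorm : Measurable fun z : ℂ => ENNReal.ofReal (‖z‖ ^ 2) := by fun_prop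
  have ml : ∀ t, Measurable fun ω =>
      ENNReal.ofReal (Real.log (1 + sqNorm (sel (C.chanH ω, C.chanG ω) t))) := fun t =>
    hlog.comp (hsel t).measurable
  have mn : ∀ t, Measurable fun ω => ENNReal.ofReal (‖noise ω t‖ ^ 2) := fun t =>
    hnorm.comp (hnoise t).measurable
  have mi : ∀ t, Measurable fun ω => ENNReal.ofReal (sqNorm (C.input ω t)) := fun t =>
    (measurable_sqNorm.comp (C.measurable_input t)).ennreal_ofReal
  have hpow : ∑ t, ∫⁻ ω, ENNReal.ofReal (sqNorm (C.input ω t)) ∂(C.law ν) ≤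
      ENNReal.ofReal (n * P) := by
    rw [← lintegral_finsetSum _ fun t _ => mi t]
    refine le_trans (lintegral_mono fun ω => ?_) hC
    rw [ENNReal.ofReal_sum_of_nonneg fun t _ => sqNorm_nonneg _]
  calc _ ≤ ∫⁻ ω, ∑ t, (ENNReal.ofReal (Real.log Real.pi + Real.log P) +
        ENNReal.ofReal (Real.log (1 + sqNorm (sel (C.chanH ω, C.chanG ω) t))) +
        ENNReal.ofReal (2 / P) * ENNReal.ofReal (sqNorm (C.input ω t)) +
        2 * ENNReal.ofReal (‖noise ω t‖ ^ 2)) ∂(C.law ν) := by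
        refine lintegral_mono fun ω => ?_
        rw [fadingDens, negLog_prod _ _
          (fun t => cgDens_pos (one_pos.trans_le (one_le_fadingVar hP0.le _)) _)
          (fun t => cgDens_le_one (one_le_fadingVar hP0.le _) _)]
        exact Finset.sum_le_sum fun t _ => negLog_cgDens_output_le _ _ _ hP
    _ = ∑ t : Fin n, (ENNReal.ofReal (Real.log Real.pi + Real.log P) + meanLog ν +
        ENNReal.ofReal (2 / P) * ∫⁻ ω, ENNReal.ofReal (sqNorm (C.input ω t)) ∂(C.law ν) +
        2 * ∫⁻ z, ENNReal.ofReal (‖z‖ ^ 2) ∂stdComplexGaussian) := by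
        rw [lintegral_finsetSum _ (by fun_prop)]
        refine Finset.sum_congr rfl fun t _ => ?_
        rw [lintegral_add_right _ ((mn t).const_mul _), lintegral_add_right _ ((mi t).const_mul _),
          lintegral_add_right _ (ml t), lintegral_const_mul _ (mn t), lintegral_const_mul _ (mi t),
          (hnoise t).lintegral_comp hnorm, (hsel t).lintegral_comp hlog, meanLog]
        simp
    _ = n * (ENNReal.ofReal (Real.log Real.pi + Real.log P) + meanLog ν) +
        ENNReal.ofReal (2 / P) *
          ∑ t : Fin n, ∫⁻ ω, ENNReal.ofReal (sqNorm (C.input ω t)) ∂(C.law ν) +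
        n * (2 * ∫⁻ z, ENNReal.ofReal (‖z‖ ^ 2) ∂stdComplexGaussian) := by
        rw [Finset.sum_add_distrib, Finset.sum_add_distrib, Finset.mul_sum]
        simp [mul_add]
    -- The constant 10 is 2 from the power constraint, `(2 / P) * (n P) = 2 n`, plus `2 * 4` from
    -- the noise.
    _ ≤ n * (ENNReal.ofReal (Real.log Real.pi + Real.log P) + meanLog ν) +
        ENNReal.ofReal (2 / P) * ENNReal.ofReal (n * P) + n * (2 * 4) := by
        gcongr
        exact lintegral_sq_norm_stdComplexGaussian
    _ = _ := by
        have : ENNReal.ofReal (2 / P) * ENNReal.ofReal (n * P) = n * 2 := by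
          rw [← ENNReal.ofReal_mul (by positivity), show 2 / P * (n * P) = n * 2 by field_simp,
            ENNReal.ofReal_mul (by positivity)]
          simp
        rw [this]
        ring

lemma outEnt_dens_fst_le {P : ℝ} (hP : 1 ≤ P) (hC : C.PowerConstraint ν P) :
    outEnt C.msgLaw (obsRef ν n) (C.dens Prod.fst) ≤
      n * (ENNReal.ofReal (Real.log Real.pi + Real.log P) + meanLog ν + 10) := by
  have hP0 : 0 ≤ P := by linarith
  have m := measurable_fadingDens (M := M) (n := n) (P := P) measurable_fst
  refine (outEnt_le_crossEnt (C.measurable_dens measurable_fst) (C.dens_pos measurable_fst)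
    (C.dens_le_one _) (C.lintegral_dens measurable_fst) m
    (fadingDens_pos hP0) (fadingDens_le_one hP0)
    (lintegral_fadingDens hP0 measurable_fst).le).trans ?_
  rw [← C.lintegral_law_fst ν (F := fun p => negLog (fadingDens P Prod.fst p.2)) (by fun_prop)]
  exact lintegral_negLog_fadingDens_le hP hC C.noiseE (C.measurePreserving_chanH ν)
    (C.measurePreserving_noiseE ν)

lemma outEnt_dens_snd_le {P : ℝ} (hP : 1 ≤ P) (hC : C.PowerConstraint ν P) :
    outEnt C.msgLaw (obsRef ν n) (C.dens Prod.snd) ≤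
      n * (ENNReal.ofReal (Real.log Real.pi + Real.log P) + meanLog ν + 10) := by
  have hP0 : 0 ≤ P := by linarith
  have m := measurable_fadingDens (M := M) (n := n) (P := P) measurable_snd
  refine (outEnt_le_crossEnt (C.measurable_dens measurable_snd) (C.dens_pos measurable_snd)
    (C.dens_le_one _) (C.lintegral_dens measurable_snd) m
    (fadingDens_pos hP0) (fadingDens_le_one hP0)
    (lintegral_fadingDens hP0 measurable_snd).le).trans ?_
  rw [← C.lintegral_law_snd ν (F := fun p => negLog (fadingDens P Prod.snd p.2)) (by fun_prop)]
  exact lintegral_negLog_fadingDens_le hP hC C.noiseB (C.measurePreserving_chanG ν)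
    (C.measurePreserving_noiseB ν)

/-! ### The converse for one code, and its asymptotics -/

/-- The converse bound for a single code. -/
theorem three_mul_log_numMsg_le {P : ℝ} (hP : 1 ≤ P) (hC : C.PowerConstraint ν P)
    (hν : meanLog ν ≠ ∞) :
    3 * ENNReal.ofReal (Real.log C.numMsg) ≤
      2 * (n * (ENNReal.ofReal (Real.log Real.pi + Real.log P) + meanLog ν + 10)) +
      2 * (C.leakage ν * ENNReal.ofReal (Real.log 2)) +
      3 * (ENNReal.ofReal (Real.log 2) + ENNReal.ofReal (Real.log C.numMsg) * C.errorProb ν) := by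
  set B := n * (ENNReal.ofReal (Real.log Real.pi + Real.log P) + meanLog ν + 10) with hB
  have hBt : B ≠ ∞ := by finiteness
  have mj := C.measurable_jointDens
  have m1 := C.measurable_dens measurable_fst
  have m2 := C.measurable_dens measurable_snd
  have U1 := outEnt_dens_fst_le hP hC
  have U2 := outEnt_dens_snd_le hP hC
  have F1 := log_add_condEnt_le (ρ := obsRef ν n) m1 (C.dens_pos measurable_fst) (C.dens_le_one _)
    (C.lintegral_dens measurable_fst) C.measurable_dec
  have F2 := log_add_condEnt_le (ρ := jointRef ν n) mj C.jointDens_pos C.jointDens_le_one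
    C.lintegral_jointDens (dec := fun o => C.dec (o.1, o.2.2))
    (C.measurable_dec.comp (by fun_prop))
  rw [← errorProb_eq_fst] at F1
  rw [← errorProb_eq_joint] at F2
  have D1 := C.condEnt_jointDens_le ν
  have D2 := C.outEnt_jointDens_le ν
  have S := C.condEnt_dens_snd_le ν
  have L := outEnt_le_condEnt_add_klDiv (τ := C.msgLaw) (ρ := obsRef ν n) m2
    (C.dens_pos measurable_snd) (C.dens_le_one _) (C.lintegral_dens measurable_snd)
    (U2.trans_lt hBt.lt_top).ne
  have hl2 : ENNReal.ofReal (Real.log 2) ≠ 0 := by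
    simpa using Real.log_pos one_lt_two
  have hleak : C.leakage ν * ENNReal.ofReal (Real.log 2) = InformationTheory.klDiv
    ((C.msgLaw.prod (obsRef ν n)).withDensity (C.dens Prod.snd))
    (C.msgLaw.prod ((obsRef ν n).withDensity (outDens C.msgLaw (C.dens Prod.snd)))) := by
    rw [leakage_eq, ENNReal.div_mul_cancel hl2 ENNReal.ofReal_ne_top]
  rw [← hleak] at L
  have hcJ : condEnt C.msgLaw (jointRef ν n) C.jointDens ≠ ∞ := by
    refine ((condEnt_le_outEnt mj C.jointDens_pos C.jointDens_le_one
      C.lintegral_jointDens).trans_lt (D2.trans_lt ?_)).ne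
    exact ENNReal.mul_lt_top (by simp) (U2.trans_lt hBt.lt_top)
  set lm := ENNReal.ofReal (Real.log C.numMsg)
  set err := ENNReal.ofReal (Real.log 2) + lm * C.errorProb ν
  set leak := C.leakage ν * ENNReal.ofReal (Real.log 2)
  set cJ := condEnt C.msgLaw (jointRef ν n) C.jointDens
  set cY := condEnt C.msgLaw (obsRef ν n) (C.dens Prod.fst)
  set cZ := condEnt C.msgLaw (obsRef ν n) (C.dens Prod.snd)
  set oJ := outEnt C.msgLaw (jointRef ν n) C.jointDens
  set oY := outEnt C.msgLaw (obsRef ν n) (C.dens Prod.fst)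
  set oZ := outEnt C.msgLaw (obsRef ν n) (C.dens Prod.snd)
  -- The entropy `cJ` is finite, so `2 * cJ` may be added to both sides. One copy is bounded by `2 *
  -- cY` for Fano's inequality with `y`, the other enters Fano's inequality with both outputs, and
  -- the secrecy bound returns `2 * cJ`.
  refine ENNReal.le_of_add_le_add_right (ENNReal.mul_ne_top (by simp : (2 : ℝ≥0∞) ≠ ∞) hcJ) ?_
  calc 3 * lm + 2 * cJ = 2 * lm + cJ + (lm + cJ) := by ring
    _ ≤ 2 * lm + 2 * cY + (oJ + err) := by gcongr
    _ = 2 * (lm + cY) + (oJ + err) := by ring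
    _ ≤ 2 * (B + err) + (2 * (cJ + leak) + err) := by
        have h1 : lm + cY ≤ B + err := F1.trans (by gcongr)
        have h2 : oJ ≤ 2 * (cJ + leak) := D2.trans (by gcongr; exact L.trans (by gcongr))
        gcongr
    _ = _ := by ring

end Code

lemma meanLog_ne_top {M : ℕ} {ν : Measure (Vec M)}
    (hν : Integrable (fun v => Real.log (1 + sqNorm v)) ν) : Code.meanLog ν ≠ ∞ :=
  hν.lintegral_lt_top.ne

/-- The converse bound for the normalized rate of a single code. -/
lemma rate_div_logb_le {M n : ℕ} {C : Code M n} {ν : Measure (Vec M)} [IsProbabilityMeasure ν]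
    (hν : Code.meanLog ν ≠ ∞) {P δ : ℝ} (hP : 1 ≤ Real.log P) (hP0 : 0 < P)
    (hδ0 : 0 < δ) (hδ1 : δ < 1)
    (hPδ : Real.log Real.pi + (Code.meanLog ν).toReal + 10 ≤ δ * Real.log P)
    (hC : C.PowerConstraint ν P) (herr : C.errorProb ν ≤ ENNReal.ofReal δ) (hn : 0 < n)
    (hnδ : 3 * Real.log 2 ≤ δ * n)
    (hleak : C.leakage ν / (n * ENNReal.ofReal (Real.logb 2 P)) ≤ ENNReal.ofReal δ) :
    C.rate / Real.logb 2 P ≤ (2 + 5 * δ) / (3 * (1 - δ)) := by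
  have hP1 : 1 ≤ P := by
    by_contra h
    have := Real.log_nonpos hP0.le (not_le.1 h).le
    linarith
  have hl2 : 0 < Real.log 2 := Real.log_pos one_lt_two
  have hlog : 0 < Real.log P := by linarith
  have hb : 0 < Real.logb 2 P := div_pos hlog hl2
  have hn' : (0 : ℝ) < n := by exact_mod_cast hn
  have lpi : 0 ≤ Real.log Real.pi := Real.log_nonneg (by linarith [Real.pi_gt_three])
  have hm : 0 ≤ Real.log C.numMsg := Real.log_natCast_nonneg _
  have hleak' : C.leakage ν ≤ ENNReal.ofReal (δ * (n * Real.logb 2 P)) := by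
    rw [ENNReal.div_le_iff_le_mul (Or.inl (by simp [hn.ne', hb])) (Or.inl (by finiteness))]
      at hleak
    rwa [ENNReal.ofReal_mul hδ0.le, ENNReal.ofReal_mul hn'.le, ENNReal.ofReal_natCast]
  have key : 3 * ENNReal.ofReal (Real.log C.numMsg) ≤
      2 * (n * (ENNReal.ofReal (Real.log Real.pi + Real.log P) + Code.meanLog ν + 10)) +
      2 * (ENNReal.ofReal (δ * (n * Real.logb 2 P)) * ENNReal.ofReal (Real.log 2)) +
      3 * (ENNReal.ofReal (Real.log 2) +
        ENNReal.ofReal (Real.log C.numMsg) * ENNReal.ofReal δ) :=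
    (Code.three_mul_log_numMsg_le hP1 hC hν).trans (by gcongr)
  have key2 : 3 * Real.log C.numMsg ≤
      2 * (n * (Real.log Real.pi + Real.log P + (Code.meanLog ν).toReal + 10)) +
      2 * (δ * (n * Real.logb 2 P) * Real.log 2) + 3 * (Real.log 2 + Real.log C.numMsg * δ) := by
    have h := ENNReal.toReal_mono (by finiteness) key
    rw [ENNReal.toReal_add (by finiteness) (by finiteness),
      ENNReal.toReal_add (by finiteness) (by finiteness)] at h
    simp only [ENNReal.toReal_mul] at h
    rw [ENNReal.toReal_add (by finiteness) (by finiteness),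
      ENNReal.toReal_add (by finiteness) (by finiteness),
      ENNReal.toReal_add (by finiteness) (by finiteness)] at h
    simp only [ENNReal.toReal_mul] at h
    rw [ENNReal.toReal_ofReal hm, ENNReal.toReal_ofReal (by positivity),
      ENNReal.toReal_ofReal (by positivity), ENNReal.toReal_ofReal hl2.le,
      ENNReal.toReal_ofReal hδ0.le] at h
    simpa using h
  have e1 : Real.logb 2 P * Real.log 2 = Real.log P := by
    rw [Real.logb, div_mul_cancel₀ _ hl2.ne']
  have e2 : C.rate / Real.logb 2 P = Real.log C.numMsg / (n * Real.log P) := by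
    rw [Code.rate, Real.logb, Real.logb]
    field_simp
  rw [e2, div_le_div_iff₀ (by positivity) (by linarith)]
  have e3 : δ * (n * Real.logb 2 P) * Real.log 2 = δ * (n * Real.log P) := by
    rw [← e1]; ring
  rw [e3] at key2
  -- In units of `n log P`, the entropy bound gives `2 + 2 δ`, the leakage `2 δ` and the term `3 log
  -- 2` at most `δ`, in total `2 + 5 δ`. The error term `3 δ log M_n` moves to the left and leaves
  -- the factor `3 (1 - δ)`.
  have h1 : n * (Real.log Real.pi + Real.log P + (Code.meanLog ν).toReal + 10) ≤
      n * (Real.log P + δ * Real.log P) :=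
    mul_le_mul_of_nonneg_left (by linarith) hn'.le
  have h2 : 3 * Real.log 2 ≤ δ * (n * Real.log P) := by
    refine hnδ.trans ?_
    gcongr
    nlinarith
  nlinarith

/-- For all large `P`, and then for all large `n` depending on `P`, leakage, error and lower-order
terms fall below `δ`. The bound for one code passes to both lower limits, each being at most the
upper limit. -/
lemma achievable_le {M : ℕ} {ν : Measure (Vec M)} [IsProbabilityMeasure ν]
    (hν : Integrable (fun v => Real.log (1 + sqNorm v)) ν) {d : ℝ≥0} (hd : Achievable ν d)
    {δ : ℝ} (hδ0 : 0 < δ) (hδ1 : δ < 1) : (d : ℝ) ≤ (2 + 5 * δ) / (3 * (1 - δ)) := by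
  obtain ⟨C, hpow, herr, hrate, hleak⟩ := hd
  have hδ : 0 < ENNReal.ofReal δ := ENNReal.ofReal_pos.2 hδ0
  have hev : ∀ᶠ P : ℝ in atTop, liminf (fun n : ℕ =>
      (((C P n).rate / Real.logb 2 P : ℝ) : EReal)) atTop ≤
      (((2 + 5 * δ) / (3 * (1 - δ)) : ℝ) : EReal) := by
    have hlog := Real.tendsto_log_atTop
    filter_upwards [hleak.eventually_lt_const hδ, eventually_gt_atTop 0,
      hlog.eventually_ge_atTop 1, (hlog.const_mul_atTop hδ0).eventually_ge_atTop
        (Real.log Real.pi + (Code.meanLog ν).toReal + 10)] with P h1 hP0 hP1 hPδ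
    refine (liminf_le_limsup).trans (limsup_le_of_le (h := ?_))
    have hnat : Tendsto (fun n : ℕ => δ * (n : ℝ)) atTop atTop :=
      tendsto_natCast_atTop_atTop.const_mul_atTop hδ0
    filter_upwards [eventually_lt_of_limsup_lt h1, (herr P hP0).eventually_lt_const hδ,
      eventually_gt_atTop 0, hnat.eventually_ge_atTop (3 * Real.log 2)] with n h2 h3 h4 h5
    exact EReal.coe_le_coe_iff.2 (rate_div_logb_le (meanLog_ne_top hν) hP1 hP0 hδ0 hδ1 hPδ
      (hpow P hP0 n) h3.le h4 h5 h2.le)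
  exact EReal.coe_le_coe_iff.1 (hrate.trans ((liminf_le_limsup).trans (limsup_le_of_le (h := hev))))

end Wiretap

end

theorem theorem1 (M : ℕ) (ν : MeasureTheory.Measure (Wiretap.Vec M))
    [MeasureTheory.IsProbabilityMeasure ν]
    (hν : MeasureTheory.Integrable (fun v => Real.log (1 + Wiretap.sqNorm v)) ν) :
    Wiretap.sdof ν ≤ 2 / 3 := by
  refine iSup₂_le fun d hd => ?_
  have h : (d : ℝ) ≤ 2 / 3 := by
    by_contra! hlt
    have hd0 : 0 ≤ (d : ℝ) := d.2
    -- The bound `d ≤ (2 + 5 δ) / (3 (1 - δ))` amounts to `3 d - 2 ≤ δ (5 + 3 d)`. Half of that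
    -- threshold violates it, and the minimum with 1/2 keeps `δ < 1`.
    set δ : ℝ := min (1 / 2) ((3 * d - 2) / (2 * (5 + 3 * d))) with hδ
    have hpos : 0 < 5 + 3 * (d : ℝ) := by linarith
    have hδ0 : 0 < δ := lt_min (by norm_num) (div_pos (by linarith) (by linarith))
    have hδ1 : δ < 1 := (min_le_left _ _).trans_lt (by norm_num)
    have hδ2 : δ * (2 * (5 + 3 * d)) ≤ 3 * d - 2 :=
      (le_div_iff₀ (by linarith)).1 (min_le_right _ _)
    have := Wiretap.achievable_le hν hd hδ0 hδ1
    rw [le_div_iff₀ (by linarith)] at this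
    nlinarith
  have h2 : d ≤ 2 / 3 := by exact_mod_cast h
  calc (d : ℝ≥0∞) ≤ ((2 / 3 : ℝ≥0) : ℝ≥0∞) := by exact_mod_cast h2
    _ = 2 / 3 := by rw [ENNReal.coe_div (by norm_num)]; simp
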